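/- Let $L$ be a language consisting of relation symbols, each of arity at least $1$, and function symbols, each of arity $0$ (*constants*) or $1$ (*unary functions*). There may be infinitely many symbols. Let $\Gamma_L$ be a group of permutations of $L$ which preserve types (relation or function) and arities. A *$\Gamma_L$-structure* $\mathbf A$ has a (possibly empty) vertex set $A$, relations $R_{\mathbf A}\subseteq A^{n}$ for every $n$-ary relation symbol $R$, and set-valued functions $F_{\mathbf A}\colon A^{n}\to\mathcal P(A)$ for every $n$-ary function symbol $F$. It is finite if $A$ is finite. For a constant $c$, write $c_{\mathbf A}\subseteq A$ for its value. An *embedding* $f\colon\mathbf A\to\mathbf B$ is a pair $(f_L,f_A)$, where $f_L\in\Gamma_L$ and $f_A\colon A\to B$ is injective, such that $\bar x\in R_{\mathbf A}\iff f_A(\bar x)\in f_L(R)_{\mathbf B}$ and $f_A(F_{\mathbf A}(\bar x))=f_L(F)_{\mathbf B}(f_A(\bar x))$ for all symbols $R$, $F$ and all tuples $\bar x$ of vertices of $\mathbf A$. It is an *isomorphism* if $f_A$ is bijective, and an *automorphism* if moreover $\mathbf A=\mathbf B$. Composition of such maps is taken in both coordinates. $\mathbf A$ is a *substructure* of $\mathbf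 B$ if $A\subseteq B$ and $(\mathrm{id}_L,\text{inclusion})$ is an embedding. A *partial automorphism* of $\mathbf A$ is an isomorphism between two substructures of $\mathbf A$; an automorphism extends it if it has the same language part and extends its vertex part. For $g\in\Gamma_L$, the *relabelled* structure $g\mathbf A$ has vertex set $A$, $R_{g\mathbf A}=(g^{-1}R)_{\mathbf A}$ and $F_{g\mathbf A}=(g^{-1}F)_{\mathbf A}$. A structure $\mathbf C$ is the *free amalgamation* of its substructures $\mathbf C_1,\mathbf C_2$ if $C=C_1\cup C_2$ and every tuple $\bar x$ of vertices of $\mathbf C$ that contains a vertex of $C_1\setminus C_2$ and a vertex of $C_2\setminus C_1$ is in no relation of $\mathbf C$ and satisfies $F_{\mathbf C}(\bar x)=\emptyset$ for every function symbol $F$ of arity $|\bar x|$. A structure is *irreducible* if it is not the free amalgamation of two proper substructures. Let $\psi\colon\mathbf A\to\mathbf B$ be an embedding of finite $\Gamma_L$-structures, and let $\psi(\mathbf A)$ be the substructure of $\mathbf B$ with vertex set $\psi(A)$. We say that $\mathbf B$ is, with respect to $\psi$, * a *coherent EPPA-witness* for $\mathbf A$ if one can assign to every partial automorphism $f$ of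 $\psi(\mathbf A)$ an automorphism $\hat f$ of $\mathbf B$ extending $f$ so that $\hat h=\hat g\circ\hat f$ whenever $f,g,h$ are partial automorphisms of $\psi(\mathbf A)$ with $\mathrm{Dom}(f)=\mathrm{Dom}(h)$, $\mathrm{Range}(f)=\mathrm{Dom}(g)$, $\mathrm{Range}(g)=\mathrm{Range}(h)$ and $h=g\circ f$; * *irreducible structure faithful* if for every irreducible substructure $\mathbf C$ of $\mathbf B$ there is an automorphism $g$ of $\mathbf B$ with $g(C)\subseteq\psi(A)$. **Theorem.** Let $L$ and $\Gamma_L$ be as above, let $\mathbf A$ be a finite $\Gamma_L$-structure, and assume the following: 1. $g(c)=c$ for every $g\in\Gamma_L$ and every constant $c\in L$. 2. $L$ has finitely many constants. 3. $c_{\mathbf A}$ is a singleton for every constant $c\in L$. 4. $c_{\mathbf A}\neq c'_{\mathbf A}$ for all distinct constants $c,c'\in L$. 5. For every constant $c\in L$ with $c_{\mathbf A}=\{a\}$ and every unary function $F\in L$, $F_{\mathbf A}(a)=\emptyset$. 6. The orbit $\{g\mathbf A: g\in\Gamma_L\}$ of $\mathbf A$ under relabelling is finite. Then there are a finite $\Gamma_L$-structure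 $\mathbf B$ and an embedding $\psi\colon\mathbf A\to\mathbf B$ with respect to which $\mathbf B$ is both a coherent EPPA-witness for $\mathbf A$ and irreducible structure faithful. -/

import Mathlib

universe u v w w'

namespace EPPA

/-- Permutations of the symbols of a language which preserve types (relation or function) and
arities. The symbols of `L` of arity `n` are `L.Relations n` and `L.Functions n`, so such a
permutation is the same as a permutation of each of these sets. -/
abbrev LangPerm (L : FirstOrder.Language.{u, v}) : Type (max u v) :=
  (∀ n, Equiv.Perm (L.Relations n)) × (∀ n, Equiv.Perm (L.Functions n))

/-- Structures with vertex set `A`, where an `n`-ary function goes from `A ^ n` to the set of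
all subsets of `A`. -/
@[ext]
structure GStr (L : FirstOrder.Language.{u, v}) (A : Type w) where
  rel : ∀ {n : ℕ}, L.Relations n → Set (Fin n → A)
  func : ∀ {n : ℕ}, L.Functions n → (Fin n → A) → Set A

namespace GStr

variable {L : FirstOrder.Language.{u, v}} {A : Type w} {B : Type w'}

/-- The value of a constant symbol (a subset of the vertex set). -/
def const (M : GStr L A) (c : L.Functions 0) : Set A := M.func c ![]

/-- The structure `g M`, the image of `M` under the pair `(g, id)`. -/
def relabel (g : LangPerm L) (M : GStr L A) : GStr L A where
  rel {n} R := M.rel ((g.1 n).symm R)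
  func {n} F := M.func ((g.2 n).symm F)

/-- The orbit of `M` under the action of the group `Γ` by relabelling. -/
def relabelOrbit (Γ : Subgroup (LangPerm L)) (M : GStr L A) : Set (GStr L A) :=
  {N | ∃ g ∈ Γ, N = M.relabel g}

/-- The pair `(g, f)` is an embedding of `M` into `N`. -/
structure IsEmbedding (g : LangPerm L) (f : A → B) (M : GStr L A) (N : GStr L B) : Prop where
  injective : Function.Injective f
  rel_iff : ∀ {n : ℕ} (R : L.Relations n) (x : Fin n → A),
    x ∈ M.rel R ↔ f ∘ x ∈ N.rel (g.1 n R)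
  func_eq : ∀ {n : ℕ} (F : L.Functions n) (x : Fin n → A),
    f '' M.func F x = N.func (g.2 n F) (f ∘ x)

/-- `S` is the vertex set of a substructure of `M`. -/
def IsClosed (M : GStr L A) (S : Set A) : Prop :=
  ∀ {n : ℕ} (F : L.Functions n) (x : Fin n → A), (∀ i, x i ∈ S) → M.func F x ⊆ S

/-- The structure induced by `M` on `S`. For closed `S` this is the substructure of `M` with
vertex set `S`. -/
def induce (M : GStr L A) (S : Set A) : GStr L S where
  rel R := {x | (fun i => (x i : A)) ∈ M.rel R}
  func F x := {y | (y : A) ∈ M.func F (fun i => (x i : A))}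

/-- `M` is the free amalgamation of its substructures on `S` and `T` (over the one on
`S ∩ T`). -/
structure IsFreeAmalgamation (M : GStr L A) (S T : Set A) : Prop where
  closed_left : M.IsClosed S
  closed_right : M.IsClosed T
  cover : S ∪ T = Set.univ
  rel_free : ∀ {n : ℕ} (R : L.Relations n) (x : Fin n → A),
    (∃ i, x i ∈ S \ T) → (∃ j, x j ∈ T \ S) → x ∉ M.rel R
  func_free : ∀ {n : ℕ} (F : L.Functions n) (x : Fin n → A),
    (∃ i, x i ∈ S \ T) → (∃ j, x j ∈ T \ S) → M.func F x = ∅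

/-- `M` is not the free amalgamation of its proper substructures. -/
def Irreducible (M : GStr L A) : Prop :=
  ¬ ∃ S T : Set A, S ≠ Set.univ ∧ T ≠ Set.univ ∧ M.IsFreeAmalgamation S T

end GStr

section

variable {L : FirstOrder.Language.{u, v}} {A : Type w} {B : Type w'}

/-- Embeddings `(lang, toFun)` with language part in `Γ`. -/
structure Emb (Γ : Subgroup (LangPerm L)) (M : GStr L A) (N : GStr L B) where
  lang : LangPerm L
  lang_mem : lang ∈ Γ
  toFun : A → B
  isEmbedding : GStr.IsEmbedding lang toFun M N

/-- Automorphisms `(lang, toPerm)` with language part in `Γ`. -/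
structure Aut (Γ : Subgroup (LangPerm L)) (N : GStr L B) where
  lang : LangPerm L
  lang_mem : lang ∈ Γ
  toPerm : Equiv.Perm B
  isEmbedding : GStr.IsEmbedding lang toPerm N N

/-- Partial automorphisms of `N`: isomorphisms `(lang, map)` between the substructures of `N`
with vertex sets `dom` and `cod`. -/
structure PartialAut (Γ : Subgroup (LangPerm L)) (N : GStr L B) where
  lang : LangPerm L
  lang_mem : lang ∈ Γ
  dom : Set B
  cod : Set B
  dom_closed : N.IsClosed dom
  cod_closed : N.IsClosed cod
  map : dom ≃ cod
  isEmbedding : GStr.IsEmbedding lang map (N.induce dom) (N.induce cod)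

variable {Γ : Subgroup (LangPerm L)} {M : GStr L A} {N : GStr L B}

/-- `f` is a partial automorphism of the substructure of `N` with vertex set `S`. (When `S` is
closed in `N`, the substructures of this substructure are those of `N` which are contained
in `S`.) -/
def PartialAut.Within (f : PartialAut Γ N) (S : Set B) : Prop :=
  f.dom ⊆ S ∧ f.cod ⊆ S

/-- The automorphism `e` extends `f` (in particular they have the same language part). -/
def PartialAut.ExtendsTo (f : PartialAut Γ N) (e : Aut Γ N) : Prop :=
  e.lang = f.lang ∧ ∀ x : f.dom, e.toPerm x = f.map x

/-- `(f, g, h)` is a coherent triple: the domains and ranges fit and `h = g ∘ f`, for both the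
vertex and the language part. -/
structure PartialAut.IsCoherentTriple (f g h : PartialAut Γ N) : Prop where
  dom_eq : f.dom = h.dom
  range_eq_dom : f.cod = g.dom
  range_eq : g.cod = h.cod
  lang_eq : h.lang = g.lang * f.lang
  map_eq : ∀ (x : B) (hf : x ∈ f.dom) (hg : (f.map ⟨x, hf⟩ : B) ∈ g.dom) (hh : x ∈ h.dom),
    (h.map ⟨x, hh⟩ : B) = g.map ⟨f.map ⟨x, hf⟩, hg⟩

/-- Coherence of a triple of automorphisms (the domains and ranges always fit). -/
def Aut.IsCoherentTriple (f g h : Aut Γ N) : Prop :=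
  h.lang = g.lang * f.lang ∧ h.toPerm = g.toPerm * f.toPerm

/-- The partial automorphisms of `ψ(M)`. -/
abbrev Emb.ImagePartialAut (ψ : Emb Γ M N) : Type _ :=
  {f : PartialAut Γ N // f.Within (Set.range ψ.toFun)}

/-- `N` is a coherent EPPA-witness for `M` via the embedding `ψ`: there is a coherent map
which assigns to each partial automorphism of `ψ(M)` an automorphism of `N` extending it. -/
def IsCoherentEPPAWitness (ψ : Emb Γ M N) : Prop :=
  ∃ E : ψ.ImagePartialAut → Aut Γ N,
    (∀ f : ψ.ImagePartialAut, f.1.ExtendsTo (E f)) ∧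
    ∀ f g h : ψ.ImagePartialAut, PartialAut.IsCoherentTriple f.1 g.1 h.1 →
      Aut.IsCoherentTriple (E f) (E g) (E h)

/-- Irreducible structure faithfulness of `N` with respect to `ψ(M)`. -/
def IsIrreducibleStructureFaithful (ψ : Emb Γ M N) : Prop :=
  ∀ S : Set B, N.IsClosed S → (N.induce S).Irreducible →
    ∃ e : Aut Γ N, e.toPerm '' S ⊆ Set.range ψ.toFun

end

end EPPA

/-! It suffices to embed the vertices of `M` in a finite set `X` on which a group acts, so that
partial automorphisms of `M` lift coherently to the group and group elements respect the structure
wherever they carry vertices of `M` to vertices of `M` (`ExtensionSystem`). The witness is then a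
union of translates of `M`.

Existence (`exists_extensionSystem`): since the orbit of `M` is finite, atomic statements ("slots")
fall into a finite set `Q` of classes, compatibly with the action. Take `X = A × (Q → ZMod p)` with
a prime `p > |A|`, and place `a` at `(a, indicator of the true slots)`. The group permutes fibres
and preserves, for each slot, the sum of its coordinate over its vertices; hence a slot carried
inside `M` keeps its truth value. A partial automorphism is lifted by a permutation of `A` followed
by translations of fibres: over its range they restore the indicator, and the other vertices of a
slot balance the sum. If a slot lies inside the range, nothing has to be balanced.

Faithfulness: a subset of `X` may fail to move into `M` although all its pairs do. Such a bad set
with `k + 2` elements is given `k + 1` colours, distinct on vertices of `M`; points of `X` are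
expanded by colours. If all pairs of a set move into `M`, its colours at a bad set are distinct, so
by pigeonhole its projection is not bad (`isTwoDetermined_coloured`).

Unary functions are handled by taking as vertices of the witness points together with their
closures. Two vertices of an irreducible substructure lie in a common translate of `M`
(`coexist_of_irreducible`), so the whole substructure moves into `M`. -/

namespace EPPA

open Relator

/-! ### Coherent extension of partial bijections. -/

/-- Partial bijections of a finite set extend to permutations in a coherent way. -/
theorem exists_coherent_extension (α : Type*) [Finite α] :
    ∃ ext : (α → α → Prop) → Equiv.Perm α,
      (∀ r, BiUnique r → ∀ x y, r x y → ext r x = y) ∧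
      ∀ r s, BiUnique r → BiUnique s → (∀ y, (∃ x, r x y) ↔ ∃ z, s y z) →
        ext (Relation.Comp r s) = ext s * ext r := by
  classical
  obtain hα | ⟨⟨a₀⟩⟩ := isEmpty_or_nonempty α
  · exact ⟨fun _ => 1, fun r _ x => hα.elim x, fun r s _ _ _ => Subsingleton.elim _ _⟩
  -- One enumeration of each subset is fixed in advance; `0` and `a₀` are junk values outside it.
  have henum : ∀ S : Set α, ∃ (rk : α → ℕ) (un : ℕ → α),
      (∀ x ∈ S, rk x < Nat.card S ∧ un (rk x) = x) ∧
      ∀ i < Nat.card S, un i ∈ S ∧ rk (un i) = i := by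
    intro S
    let e := Finite.equivFin S
    refine ⟨fun x => if h : x ∈ S then e ⟨x, h⟩ else 0,
      fun i => if h : i < Nat.card S then e.symm ⟨i, h⟩ else a₀, ?_, ?_⟩
    · intro x hx
      simp [hx, -Nat.card_coe_set_eq]
    · intro i hi
      simp [hi, -Nat.card_coe_set_eq]
  choose rk un hrk hun using henum
  let D : (α → α → Prop) → Set α := fun r => {x | ∃ y, r x y}
  let R : (α → α → Prop) → Set α := fun r => {y | ∃ x, r x y}
  -- The `i`-th point outside the domain goes to the `i`-th point outside the range. Ranks are kept,
  -- whence coherence.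
  let F : (α → α → Prop) → α → α := fun r x =>
    if h : ∃ y, r x y then h.choose else un (R r)ᶜ (rk (D r)ᶜ x)
  have hF : ∀ r, BiUnique r → ∀ x y, r x y → F r x = y := by
    intro r hr x y hxy
    have h : ∃ y, r x y := ⟨y, hxy⟩
    simp only [F, dif_pos h]
    exact hr.2 h.choose_spec hxy
  have hF' : ∀ r x, x ∉ D r → F r x = un (R r)ᶜ (rk (D r)ᶜ x) := fun r x hx => dif_neg hx
  have hcard : ∀ r, BiUnique r → Nat.card ↥(D r)ᶜ = Nat.card ↥(R r)ᶜ := by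
    intro r hr
    have h1 : (D r).ncard = (R r).ncard := by
      refine Set.ncard_congr (fun x _ => F r x) ?_ ?_ ?_
      · rintro x ⟨y, hy⟩
        exact ⟨x, by rwa [hF r hr x y hy]⟩
      · rintro x x' ⟨y, hy⟩ ⟨y', hy'⟩ h
        rw [hF r hr x y hy, hF r hr x' y' hy'] at h
        exact hr.1 hy (h ▸ hy')
      · rintro y ⟨x, hx⟩
        exact ⟨x, ⟨y, hx⟩, hF r hr x y hx⟩
    have h2 := Set.ncard_add_ncard_compl (D r)
    have h3 := Set.ncard_add_ncard_compl (R r)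
    rw [Nat.card_coe_set_eq, Nat.card_coe_set_eq]
    omega
  have hmem : ∀ r, BiUnique r → ∀ x, x ∉ D r → F r x ∉ R r ∧ rk (R r)ᶜ (F r x) = rk (D r)ᶜ x := by
    intro r hr x hx
    rw [hF' r x hx]
    exact hun (R r)ᶜ _ (hcard r hr ▸ (hrk (D r)ᶜ x hx).1)
  have hinj : ∀ r, BiUnique r → Function.Bijective (F r) := by
    intro r hr
    rw [← Finite.injective_iff_bijective]
    intro x x' h
    by_cases hx : x ∈ D r <;> by_cases hx' : x' ∈ D r
    · obtain ⟨y, hy⟩ := hx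
      obtain ⟨y', hy'⟩ := hx'
      rw [hF r hr x y hy, hF r hr x' y' hy'] at h
      exact hr.1 hy (h ▸ hy')
    · obtain ⟨y, hy⟩ := hx
      exact ((hmem r hr x' hx').1 ⟨x, by rwa [← h, hF r hr x y hy]⟩).elim
    · obtain ⟨y, hy⟩ := hx'
      exact ((hmem r hr x hx).1 ⟨x', by rwa [h, hF r hr x' y hy]⟩).elim
    · rw [← (hrk (D r)ᶜ x hx).2, ← (hmem r hr x hx).2, h, (hmem r hr x' hx').2,
        (hrk (D r)ᶜ x' hx').2]
  let ext : (α → α → Prop) → Equiv.Perm α := fun r =>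
    if h : Function.Bijective (F r) then Equiv.ofBijective (F r) h else 1
  have hext : ∀ r, BiUnique r → ∀ x, ext r x = F r x := by
    intro r hr x
    simp [ext, hinj r hr]
  refine ⟨ext, fun r hr x y hxy => by rw [hext r hr, hF r hr x y hxy], ?_⟩
  intro r s hr hs hrs
  have hc : BiUnique (Relation.Comp r s) := by
    constructor
    · rintro x x' z ⟨y, h1, h2⟩ ⟨y', h1', h2'⟩
      obtain rfl := hs.1 h2 h2'
      exact hr.1 h1 h1'
    · rintro x z z' ⟨y, h1, h2⟩ ⟨y', h1', h2'⟩
      obtain rfl := hr.2 h1 h1'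
      exact hs.2 h2 h2'
  have hRD : R r = D s := Set.ext hrs
  have hDD : D (Relation.Comp r s) = D r := by
    ext x
    constructor
    · rintro ⟨z, y, h, -⟩
      exact ⟨y, h⟩
    · rintro ⟨y, h⟩
      obtain ⟨z, hz⟩ := (hrs y).1 ⟨x, h⟩
      exact ⟨z, y, h, hz⟩
  have hRR : R (Relation.Comp r s) = R s := by
    ext z
    constructor
    · rintro ⟨x, y, -, h⟩
      exact ⟨y, h⟩
    · rintro ⟨y, h⟩
      obtain ⟨x, hx⟩ := (hrs y).2 ⟨z, h⟩
      exact ⟨x, y, hx, h⟩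
  ext x
  rw [Equiv.Perm.mul_apply, hext _ hc, hext r hr, hext s hs]
  by_cases hx : x ∈ D r
  · obtain ⟨y, hy⟩ := hx
    obtain ⟨z, hz⟩ := (hrs y).1 ⟨x, hy⟩
    rw [hF r hr x y hy, hF s hs y z hz, hF _ hc x z ⟨y, hy, hz⟩]
  · have h := hmem r hr x hx
    rw [hF' _ x (by rwa [hDD]), hF' s (F r x) (by rw [← hRD]; exact h.1), ← hRD, h.2, hDD, hRR]

/-! ### Extension systems. -/

variable {L : FirstOrder.Language.{u, v}} {A : Type w}

/-- The pair `(g, r)` is a partial automorphism of `M`, given by the graph `r` of its vertex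
part. -/
structure IsPartialIso {Γ : Subgroup (LangPerm L)} (M : GStr L A) (g : Γ) (r : A → A → Prop) :
    Prop where
  biUnique : Relator.BiUnique r
  rel : ∀ {n : ℕ} (R : L.Relations n) (x y : Fin n → A), (∀ i, r (x i) (y i)) →
    (x ∈ M.rel R ↔ y ∈ M.rel (g.1.1 n R))
  func : ∀ (F : L.Functions 1) (a b : A), r a b → ∀ a' ∈ M.func F ![a],
    ∃ b' ∈ M.func (g.1.2 1 F) ![b], r a' b'
  func' : ∀ (F : L.Functions 1) (a b : A), r a b → ∀ b' ∈ M.func (g.1.2 1 F) ![b],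
    ∃ a' ∈ M.func F ![a], r a' b'
  const : ∀ (c : L.Functions 0), ∀ a ∈ M.const c, r a a

/-- A group acting on a set which contains the vertices of `M`, such that group elements induce
partial automorphisms of `M`, and partial automorphisms of `M` extend coherently to group
elements. -/
structure ExtensionSystem (Γ : Subgroup (LangPerm L)) (M : GStr L A) (X : Type w') where
  grp : Subgroup (Γ × Equiv.Perm X)
  emb : A → X
  emb_injective : Function.Injective emb
  rel : ∀ γ ∈ grp, ∀ {n : ℕ} (R : L.Relations n) (x y : Fin n → A),
    (∀ i, γ.2 (emb (x i)) = emb (y i)) → x ∈ M.rel R → y ∈ M.rel (γ.1.1.1 n R)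
  -- The function value must be carried into `M` too; the image of `a` alone does not control it.
  func : ∀ γ ∈ grp, ∀ (F : L.Functions 1) (a b : A) (S : Set A), γ.2 (emb a) = emb b →
    γ.2 '' (emb '' M.func F ![a]) = emb '' S → M.func (γ.1.1.2 1 F) ![b] = S
  const : ∀ γ ∈ grp, ∀ (c : L.Functions 0), ∀ a ∈ M.const c, γ.2 (emb a) = emb a
  lift : Γ → (A → A → Prop) → Equiv.Perm X
  lift_mem : ∀ g r, IsPartialIso M g r → (g, lift g r) ∈ grp
  lift_apply : ∀ g r, IsPartialIso M g r → ∀ a b, r a b → lift g r (emb a) = emb b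
  lift_comp : ∀ g r g' r', IsPartialIso M g r → IsPartialIso M g' r' →
    (∀ y, (∃ x, r x y) ↔ ∃ z, r' y z) →
    lift (g' * g) (Relation.Comp r r') = lift g' r' * lift g r

/-! ### Fibre translations that balance sums over supports. -/

section Averaging

variable {A : Type w} {H : Type*} [Group H] {Q : Type} [MulAction (H × Equiv.Perm A) Q]

/-- A weight which is `1` on `Y`, constant on `S \ Y`, and which has sum `0` over `S` if
`S \ Y` is nonempty and its size is invertible. -/
noncomputable def balancingWeight (p : ℕ) [Fact p.Prime] (Y : Set A) (S : Finset A) (b : A) :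
    ZMod p :=
  open Classical in
  if b ∈ Y then 1 else -((S.filter (· ∈ Y)).card : ZMod p) / ((S.filter (· ∉ Y)).card : ZMod p)

/-- The part of `S` outside `Y` has positive size less than `p`, hence invertible, so its weights
cancel those of `S ∩ Y`. -/
theorem sum_balancingWeight [Finite A] (p : ℕ) [Fact p.Prime] (hp : Nat.card A < p) (Y : Set A)
    (S : Finset A) (hS : ¬ ∀ a ∈ S, a ∈ Y) : ∑ b ∈ S, balancingWeight p Y S b = 0 := by
  classical
  have := Fintype.ofFinite A
  have h0 : ((S.filter (· ∉ Y)).card : ZMod p) ≠ 0 := by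
    rw [Ne, ZMod.natCast_eq_zero_iff]
    intro hdvd
    push Not at hS
    obtain ⟨a, ha, haY⟩ := hS
    have hpos : 0 < (S.filter (· ∉ Y)).card :=
      Finset.card_pos.2 ⟨a, Finset.mem_filter.2 ⟨ha, haY⟩⟩
    have hle : (S.filter (· ∉ Y)).card ≤ Nat.card A := by
      rw [Nat.card_eq_fintype_card]
      exact Finset.card_le_univ _
    exact absurd (Nat.le_of_dvd hpos hdvd) (by omega)
  rw [← Finset.sum_filter_add_sum_filter_not S (· ∈ Y)]
  rw [Finset.sum_congr rfl (g := fun _ => (1 : ZMod p)) (fun b hb => by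
    simp [balancingWeight, (Finset.mem_filter.1 hb).2])]
  rw [Finset.sum_congr (s₁ := S.filter (· ∉ Y)) rfl (g := fun _ =>
    -((S.filter (· ∈ Y)).card : ZMod p) / ((S.filter (· ∉ Y)).card : ZMod p)) (fun b hb => by
    rw [balancingWeight, if_neg (Finset.mem_filter.1 hb).2])]
  rw [Finset.sum_const, Finset.sum_const, nsmul_eq_mul, nsmul_eq_mul]
  field_simp
  ring

theorem balancingWeight_map (p : ℕ) [Fact p.Prime] (Y Z : Set A) (S : Finset A)
    (σ : Equiv.Perm A) (hσ : ∀ a, a ∈ Y ↔ σ a ∈ Z) (b : A) :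
    balancingWeight p Z (S.map σ.toEmbedding) (σ b) = balancingWeight p Y S b := by
  classical
  have h1 : (S.map σ.toEmbedding).filter (· ∈ Z) = (S.filter (· ∈ Y)).map σ.toEmbedding := by
    rw [Finset.filter_map]
    congr 1
    ext a
    simp [hσ]
  have h2 : (S.map σ.toEmbedding).filter (· ∉ Z) = (S.filter (· ∉ Y)).map σ.toEmbedding := by
    rw [Finset.filter_map]
    congr 1
    ext a
    simp [hσ]
  unfold balancingWeight
  simp only [← hσ b]
  split_ifs
  · rfl
  · have e1 := congrArg Finset.card h1
    have e2 := congrArg Finset.card h2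
    rw [Finset.card_map] at e1 e2
    congr! 3

/-- The range of a relation. -/
def relRange (r : A → A → Prop) : Set A := {b | ∃ a, r a b}

/-- The permutation of `A × (Q → R)` which acts through `(g, σ)`, followed by a translation in
each fibre. -/
def twistedPerm {R : Type*} [AddCommGroup R] (g : H) (σ : Equiv.Perm A) (τ : A → Q → R) :
    Equiv.Perm (A × (Q → R)) where
  toFun v := (σ v.1, fun q => v.2 ((g, σ)⁻¹ • q) + τ (σ v.1) q)
  invFun v := (σ⁻¹ v.1, fun q => v.2 ((g, σ) • q) - τ v.1 ((g, σ) • q))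
  left_inv v := by ext <;> simp [-Prod.inv_mk]
  right_inv v := by ext <;> simp [-Prod.inv_mk]

/-- Partial isomorphisms with respect to a marking `m` of a set `Q` of slots, each of which has
a support in `A`; they fix `K` pointwise. -/
structure IsSlotIso (supp : Q → Finset A) (m : Q → Prop) (K : Set A) (g : H)
    (r : A → A → Prop) : Prop where
  biUnique : Relator.BiUnique r
  fix : ∀ k ∈ K, r k k
  mark : ∀ q, ∀ σ : Equiv.Perm A, (∀ a b, r a b → σ a = b) → (∀ a ∈ supp q, ∃ b, r a b) →
    (m ((g, σ) • q) ↔ m q)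

/-- The permutations of `A × (Q → R)` which permute the fibres, fix the points `(k, μ)` for
`k ∈ K`, and preserve the sums over supports. -/
def fibreSumGroup {R : Type*} [AddCommGroup R] (supp : Q → Finset A)
    (hsupp : ∀ (g : H) (σ : Equiv.Perm A) (q : Q),
      supp ((g, σ) • q) = (supp q).map σ.toEmbedding) (μ : Q → R) (K : Set A) :
    Subgroup (H × Equiv.Perm (A × (Q → R))) where
  carrier := {γ | ∃ σ : Equiv.Perm A, (∀ v, (γ.2 v).1 = σ v.1) ∧
    (∀ k ∈ K, γ.2 (k, μ) = (k, μ)) ∧ ∀ (q : Q) (s : A → Q → R),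
      ∑ a ∈ supp q, (γ.2 (a, s a)).2 ((γ.1, σ) • q) = ∑ a ∈ supp q, s a q}
  one_mem' := ⟨1, by simp, by simp, fun q s => by
    simp only [Prod.fst_one, Prod.snd_one, Equiv.Perm.one_apply]
    rw [show ((1, 1) : H × Equiv.Perm A) = 1 from rfl, one_smul]⟩
  mul_mem' := by
    rintro ⟨g, β⟩ ⟨g', β'⟩ ⟨σ, h1, h2, h3⟩ ⟨σ', h1', h2', h3'⟩
    refine ⟨σ * σ', fun v => by simp_all, fun k hk => by simp_all, fun q s => ?_⟩
    -- The sum condition for the outer factor is used on the section obtained from `s` by applying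
    -- `β'`.
    have e := h3 ((g', σ') • q) (fun b => (β' (σ'⁻¹ b, s (σ'⁻¹ b))).2)
    rw [hsupp, Finset.sum_map, Finset.sum_map] at e
    simp only [Equiv.coe_toEmbedding, Equiv.Perm.inv_def, Equiv.symm_apply_apply] at e h3' h1'
    rw [← h3' q s, ← e]
    refine Finset.sum_congr rfl fun a _ => ?_
    have : β' (a, s a) = (σ' a, (β' (a, s a)).2) := Prod.ext (h1' _) rfl
    rw [Prod.mk_mul_mk, ← Prod.mk_mul_mk g g' σ σ', mul_smul, Equiv.Perm.mul_apply, ← this]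
  inv_mem' := by
    rintro ⟨g, β⟩ ⟨σ, h1, h2, h3⟩
    have h1' : ∀ v, (β⁻¹ v).1 = σ⁻¹ v.1 := fun v => by
      rw [Equiv.Perm.eq_inv_iff_eq, ← h1, Equiv.Perm.inv_def, Equiv.apply_symm_apply]
    refine ⟨σ⁻¹, h1', fun k hk => by
      rw [Prod.snd_inv, Equiv.Perm.inv_eq_iff_eq]; exact (h2 k hk).symm, fun q s => ?_⟩
    have e := h3 ((g, σ)⁻¹ • q) (fun a => (β⁻¹ (σ a, s (σ a))).2)
    simp only [smul_inv_smul] at e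
    rw [Prod.inv_mk, hsupp, Finset.sum_map, Finset.sum_map] at e
    simp only [Equiv.coe_toEmbedding, Equiv.Perm.inv_def, Equiv.apply_symm_apply] at e
    refine e.symm.trans (Finset.sum_congr rfl fun a _ => ?_)
    have : (σ.symm a, (β.symm (a, s a)).2) = β.symm (a, s a) := Prod.ext (h1' (a, s a)).symm rfl
    rw [this, Equiv.apply_symm_apply]

variable {supp : Q → Finset A}
  (hsupp : ∀ (g : H) (σ : Equiv.Perm A) (q : Q), supp ((g, σ) • q) = (supp q).map σ.toEmbedding)
  {m : Q → Prop} {K : Set A}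

/-- The indicator of a predicate with values in `ZMod p`. -/
noncomputable def indicatorZMod (p : ℕ) (m : Q → Prop) (q : Q) : ZMod p :=
  open Classical in if m q then 1 else 0

theorem indicatorZMod_congr {p : ℕ} {m : Q → Prop} {q q' : Q} (h : m q ↔ m q') :
    indicatorZMod p m q = indicatorZMod p m q' := by
  by_cases h' : m q' <;> simp [indicatorZMod, h', h]

/-- For the constant section at the indicator, the preserved sum is the mark times `|supp q|`, which
is nonzero modulo `p` because `0 < |supp q| < p`. -/
theorem mark_iff_of_mem_fibreSumGroup [Finite A] {p : ℕ} [Fact p.Prime] (hp : Nat.card A < p)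
    {γ : H × Equiv.Perm (A × (Q → ZMod p))} {σ : Equiv.Perm A} {q : Q}
    (hne : (supp q).Nonempty)
    (h : ∀ a ∈ supp q, γ.2 (a, indicatorZMod p m) = (σ a, indicatorZMod p m))
    (hσ : ∀ (q : Q) (s : A → Q → ZMod p),
      ∑ a ∈ supp q, (γ.2 (a, s a)).2 ((γ.1, σ) • q) = ∑ a ∈ supp q, s a q) :
    m ((γ.1, σ) • q) ↔ m q := by
  have := Fintype.ofFinite A
  have e := hσ q (fun _ => indicatorZMod p m)
  rw [Finset.sum_congr rfl (g := fun _ => indicatorZMod p m ((γ.1, σ) • q))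
    (fun a ha => by rw [h a ha]), Finset.sum_const, Finset.sum_const, nsmul_eq_mul,
    nsmul_eq_mul] at e
  have h0 : ((supp q).card : ZMod p) ≠ 0 := by
    rw [Ne, ZMod.natCast_eq_zero_iff]
    intro hdvd
    have hle : (supp q).card ≤ Nat.card A := by
      rw [Nat.card_eq_fintype_card]
      exact Finset.card_le_univ _
    exact absurd (Nat.le_of_dvd (Finset.card_pos.2 hne) hdvd) (by omega)
  have e' := mul_left_cancel₀ h0 e
  unfold indicatorZMod at e'
  by_cases h1 : m ((γ.1, σ) • q) <;> by_cases h2 : m q <;> simp_all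

/-- The translation parts which make a slot isomorphism with vertex part `σ` fix `m`. -/
noncomputable def balancingShift (p : ℕ) [Fact p.Prime] (supp : Q → Finset A) (m : Q → Prop)
    (g : H) (σ : Equiv.Perm A) (Y : Set A) (b : A) (q : Q) : ZMod p :=
  balancingWeight p Y (supp q) b *
    (indicatorZMod p m q - indicatorZMod p m ((g, σ)⁻¹ • q))

include hsupp

/-- The translations change a slot sum by the total weight times the change of mark. The mark is
unchanged if the image of the support lies in the range; otherwise the total weight is `0`. -/
theorem twistedPerm_mem_fibreSumGroup [Finite A] {p : ℕ} [Fact p.Prime] (hp : Nat.card A < p)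
    {g : H} {r : A → A → Prop} (hr : IsSlotIso supp m K g r) {σ : Equiv.Perm A}
    (hσ : ∀ a b, r a b → σ a = b) :
    (g, twistedPerm g σ (balancingShift p supp m g σ (relRange r))) ∈
      fibreSumGroup supp hsupp (indicatorZMod p m) K := by
  refine ⟨σ, fun v => rfl, fun k hk => ?_, fun q s => ?_⟩
  · have hk' := hσ k k (hr.fix k hk)
    refine Prod.ext hk' (funext fun q => ?_)
    have : k ∈ relRange r := ⟨k, hr.fix k hk⟩
    simp only [twistedPerm, balancingShift, balancingWeight, Equiv.coe_fn_mk, hk', this, if_true]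
    ring
  · simp only [twistedPerm, Equiv.coe_fn_mk, inv_smul_smul, Finset.sum_add_distrib,
      add_eq_left]
    have e : ∑ a ∈ supp q, balancingShift p supp m g σ (relRange r) (σ a) ((g, σ) • q) =
        ∑ b ∈ supp ((g, σ) • q), balancingShift p supp m g σ (relRange r) b ((g, σ) • q) := by
      rw [hsupp, Finset.sum_map]
      rfl
    rw [e]
    simp only [balancingShift, inv_smul_smul]
    rw [← Finset.sum_mul]
    by_cases h : ∀ b ∈ supp ((g, σ) • q), b ∈ relRange r
    · rw [indicatorZMod_congr (hr.mark q σ hσ ?_), sub_self, mul_zero]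
      intro a ha
      obtain ⟨a', ha'⟩ := h (σ a) (by rw [hsupp]; exact Finset.mem_map_of_mem _ ha)
      have := hσ _ _ ha'
      exact ⟨σ a, by rwa [σ.injective this] at ha'⟩
    · rw [sum_balancingWeight p hp _ _ h, zero_mul]

-- Over the range the weight is `1`, so the translation replaces the transported indicator by the
-- indicator.
omit hsupp in
theorem twistedPerm_apply_of_rel {p : ℕ} [Fact p.Prime]
    {g : H} {r : A → A → Prop} {σ : Equiv.Perm A}
    (hσ : ∀ a b, r a b → σ a = b) {a b : A} (hab : r a b) :
    twistedPerm g σ (balancingShift p supp m g σ (relRange r)) (a, indicatorZMod p m) =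
      (b, indicatorZMod p m) := by
  refine Prod.ext (hσ a b hab) (funext fun q => ?_)
  have : b ∈ relRange r := ⟨a, hab⟩
  simp only [twistedPerm, balancingShift, balancingWeight, Equiv.coe_fn_mk, hσ a b hab, this,
    if_true]
  ring

/-- `σ'` carries the range of `r` onto that of `r'`, which is also the range of the composite. The
weights therefore agree and the differences of indicators telescope. -/
theorem twistedPerm_comp {p : ℕ} [Fact p.Prime] {g g' : H} {r r' : A → A → Prop}
    {σ σ' : Equiv.Perm A} (hσ' : ∀ a b, r' a b → σ' a = b)
    (hrr : ∀ y, (∃ x, r x y) ↔ ∃ z, r' y z) :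
    twistedPerm (g' * g) (σ' * σ)
        (balancingShift p supp m (g' * g) (σ' * σ) (relRange (Relation.Comp r r'))) =
      twistedPerm g' σ' (balancingShift p supp m g' σ' (relRange r')) *
        twistedPerm g σ (balancingShift p supp m g σ (relRange r)) := by
  have hR : relRange (Relation.Comp r r') = relRange r' := by
    ext z
    constructor
    · rintro ⟨x, y, -, h⟩
      exact ⟨y, h⟩
    · rintro ⟨y, h⟩
      obtain ⟨x, hx⟩ := (hrr y).2 ⟨z, h⟩
      exact ⟨x, y, hx, h⟩
  have hRR : ∀ a, a ∈ relRange r ↔ σ' a ∈ relRange r' := by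
    intro a
    refine (hrr a).trans ⟨?_, ?_⟩
    · rintro ⟨z, hz⟩
      exact ⟨a, by rwa [hσ' a z hz]⟩
    · rintro ⟨y, hy⟩
      exact ⟨σ' a, by rwa [σ'.injective (hσ' _ _ hy)] at hy⟩
  ext v q
  · rfl
  · simp only [Equiv.Perm.mul_apply, twistedPerm, Equiv.coe_fn_mk]
    rw [hR, ← Prod.mk_mul_mk, mul_inv_rev, mul_smul, add_assoc]
    congr 1
    unfold balancingShift
    have e : balancingWeight p (relRange r) (supp ((g', σ')⁻¹ • q)) (σ v.1) =
        balancingWeight p (relRange r') (supp q) (σ' (σ v.1)) := by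
      rw [← balancingWeight_map p _ _ _ σ' hRR, ← hsupp g', smul_inv_smul]
    rw [e, ← Prod.mk_mul_mk, mul_inv_rev, mul_smul]
    ring

end Averaging

/-! ### Slots and existence of an extension system. -/

section Slots

variable {L : FirstOrder.Language.{u, v}} {A : Type w}

/-- The atomic statements about structures with vertex set `A`: a tuple is in a relation, or the
value of a unary function at a vertex is a given set. -/
inductive Slot (L : FirstOrder.Language.{u, v}) (A : Type w) : Type (max u v w)
  | rel {n : ℕ} (R : L.Relations n) (x : Fin n → A) : Slot L A
  | func (F : L.Functions 1) (a : A) (S : Set A) : Slot L A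

namespace Slot

/-- The statement holds in the structure. -/
def Holds (N : GStr L A) : Slot L A → Prop
  | rel R x => x ∈ N.rel R
  | func F a S => N.func F ![a] = S

/-- The vertices which occur in a statement. -/
def vertices : Slot L A → Set A
  | rel _ x => Set.range x
  | func _ a S => insert a S

variable {Γ : Subgroup (LangPerm L)}

instance : MulAction (Γ × Equiv.Perm A) (Slot L A) where
  smul θ
    | rel (n := n) R x => rel (θ.1.1.1 n R) (θ.2 ∘ x)
    | func F a S => func (θ.1.1.2 1 F) (θ.2 a) (θ.2 '' S)
  one_smul
    | rel _ _ => rfl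
    | func _ _ S => congrArg _ (Set.image_id S)
  mul_smul θ θ'
    | rel _ _ => rfl
    | func _ _ S => congrArg _ (Set.image_comp θ.2 θ'.2 S)

theorem smul_rel (θ : Γ × Equiv.Perm A) {n : ℕ} (R : L.Relations n) (x : Fin n → A) :
    θ • rel R x = rel (θ.1.1.1 n R) (θ.2 ∘ x) := rfl

theorem smul_func (θ : Γ × Equiv.Perm A) (F : L.Functions 1) (a : A) (S : Set A) :
    θ • func F a S = func (θ.1.1.2 1 F) (θ.2 a) (θ.2 '' S) := rfl

theorem vertices_smul (θ : Γ × Equiv.Perm A) (s : Slot L A) :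
    (θ • s).vertices = θ.2 '' s.vertices := by
  cases s with
  | rel R x => rw [smul_rel, vertices, vertices, Set.range_comp]
  | func F a S => rw [smul_func, vertices, vertices, Set.image_insert_eq]

/-- Moves the language part into a relabelling, so that only vertex permutations and the finite
orbit of `M` matter. -/
theorem holds_smul (N : GStr L A) (g : Γ) (σ : Equiv.Perm A) (s : Slot L A) :
    ((g, σ) • s).Holds N ↔ (((1, σ) : Γ × Equiv.Perm A) • s).Holds (N.relabel (g⁻¹ : Γ)) := by
  cases s <;> exact Iff.rfl

end Slot

variable {Γ : Subgroup (LangPerm L)}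

/-- Slots are identified when they have the same vertices and, after every permutation of `A`, the
same truth value in each structure of the orbit. The orbit is stable under relabelling, so the
action descends. -/
theorem exists_finite_slot_quotient [Finite A] (M : GStr L A) (horbit : (M.relabelOrbit Γ).Finite) :
    ∃ (n : ℕ) (q : Slot L A → Fin n), Function.Surjective q ∧
      ∀ s s', q s = q s' → s.vertices = s'.vertices ∧ (s.Holds M ↔ s'.Holds M) ∧
        ∀ θ : Γ × Equiv.Perm A, q (θ • s) = q (θ • s') := by
  have : Finite (M.relabelOrbit Γ) := horbit
  let f : Slot L A → Set A × (Equiv.Perm A → M.relabelOrbit Γ → Prop) := fun s =>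
    (s.vertices, fun τ N => (((1, τ) : Γ × Equiv.Perm A) • s).Holds N.1)
  obtain ⟨n, ⟨e⟩⟩ := Finite.exists_equiv_fin (Set.range f)
  refine ⟨n, e ∘ Set.rangeFactorization f, e.surjective.comp Set.rangeFactorization_surjective, ?_⟩
  have key : ∀ s s', (e ∘ Set.rangeFactorization f) s = (e ∘ Set.rangeFactorization f) s' ↔
      f s = f s' := by
    intro s s'
    rw [Function.comp_apply, Function.comp_apply, e.apply_eq_iff_eq, Subtype.ext_iff]
    rfl
  intro s s' h
  rw [key] at h
  have h1 : s.vertices = s'.vertices := congrArg Prod.fst h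
  have h2 : ∀ (τ : Equiv.Perm A) (N), N ∈ M.relabelOrbit Γ →
      ((((1, τ) : Γ × Equiv.Perm A) • s).Holds N ↔
        (((1, τ) : Γ × Equiv.Perm A) • s').Holds N) := fun τ N hN =>
    iff_of_eq (congrFun (congrFun (congrArg Prod.snd h) τ) ⟨N, hN⟩)
  refine ⟨h1, ?_, fun θ => ?_⟩
  · have := h2 1 M ⟨1, Γ.one_mem, rfl⟩
    rwa [show ((1, 1) : Γ × Equiv.Perm A) = 1 from rfl, one_smul, one_smul] at this
  · rw [key]
    refine Prod.ext ?_ ?_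
    · simp only [f, Slot.vertices_smul, h1]
    · funext τ N
      obtain ⟨N, g, hg, rfl⟩ := N
      obtain ⟨h, σ⟩ := θ
      simp only [f, smul_smul, Prod.mk_mul_mk, one_mul]
      rw [Slot.holds_smul _ h _ s, Slot.holds_smul _ h _ s']
      exact propext (h2 _ _ ⟨_, Γ.mul_mem (h⁻¹).2 hg, rfl⟩)

/-- The vertices of a function slot include its proposed value, so `r` determines `σ` on all of it.
-/
theorem IsPartialIso.holds_smul_iff {M : GStr L A} {g : Γ} {r : A → A → Prop}
    (hr : IsPartialIso M g r) {σ : Equiv.Perm A} (hσ : ∀ a b, r a b → σ a = b) {s : Slot L A}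
    (hs : ∀ a ∈ s.vertices, ∃ b, r a b) : ((g, σ) • s).Holds M ↔ s.Holds M := by
  have hs' : ∀ a ∈ s.vertices, r a (σ a) := fun a ha => by
    obtain ⟨b, hb⟩ := hs a ha
    rwa [hσ a b hb]
  cases s with
  | rel R x => exact (hr.rel R x (σ ∘ x) fun i => hs' _ ⟨i, rfl⟩).symm
  | func F a S =>
    have ha := hs' a (Set.mem_insert _ _)
    have hS : ∀ b ∈ S, r b (σ b) := fun b hb => hs' b (Set.mem_insert_of_mem _ hb)
    change M.func (g.1.2 1 F) ![σ a] = σ '' S ↔ M.func F ![a] = S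
    constructor
    · intro h
      ext b
      constructor
      · intro hb
        obtain ⟨b', hb', hbb⟩ := hr.func F a _ ha b hb
        rw [h] at hb'
        obtain ⟨c, hc, rfl⟩ := hb'
        rwa [σ.injective (hσ _ _ hbb)]
      · intro hb
        obtain ⟨b', hb', hbb⟩ := hr.func' F a _ ha (σ b) (by rw [h]; exact ⟨b, hb, rfl⟩)
        rwa [← σ.injective (hσ _ _ hbb)]
    · intro h
      ext b
      constructor
      · intro hb
        obtain ⟨b', hb', hbb⟩ := hr.func' F a _ ha b hb
        exact ⟨b', h ▸ hb', hσ _ _ hbb⟩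
      · rintro ⟨c, hc, rfl⟩
        obtain ⟨b', hb', hbb⟩ := hr.func F a _ ha c (by rwa [h])
        rwa [hσ _ _ hbb]

theorem exists_extensionSystem (hRel : IsEmpty (L.Relations 0)) [Finite A] (M : GStr L A)
    (horbit : (M.relabelOrbit Γ).Finite) :
    ∃ (X : Type w) (_ : Finite X), Nonempty (ExtensionSystem Γ M X) := by
  classical
  have := Fintype.ofFinite A
  obtain ⟨n, q, hq, hqq⟩ := exists_finite_slot_quotient (Γ := Γ) M horbit
  obtain ⟨p, hpA, hp⟩ := Nat.exists_infinite_primes (Nat.card A + 1)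
  have : Fact p.Prime := ⟨hp⟩
  have : NeZero p := ⟨hp.ne_zero⟩
  let actq : SMul (Γ × Equiv.Perm A) (Fin n) :=
    ⟨fun θ i => q (θ • Function.surjInv hq i)⟩
  have hact : ∀ (θ : Γ × Equiv.Perm A) s, q (θ • s) = θ • q s := fun θ s =>
    ((hqq _ _ (Function.surjInv_eq hq (q s))).2.2 θ).symm
  let act : MulAction (Γ × Equiv.Perm A) (Fin n) := hq.mulAction q hact
  let supp : Fin n → Finset A := fun i => (Function.surjInv hq i).vertices.toFinset
  have hsuppq : ∀ s, (supp (q s) : Set A) = s.vertices := fun s => by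
    simp only [supp, Set.coe_toFinset]
    exact (hqq _ _ (Function.surjInv_eq hq (q s))).1
  have hsupp : ∀ (g : Γ) (σ : Equiv.Perm A) (i : Fin n),
      supp ((g, σ) • i) = (supp i).map σ.toEmbedding := by
    intro g σ i
    obtain ⟨s, rfl⟩ := hq i
    rw [← Finset.coe_inj, Finset.coe_map, ← hact, hsuppq, hsuppq, Slot.vertices_smul]
    rfl
  let m : Fin n → Prop := fun i => (Function.surjInv hq i).Holds M
  have hm : ∀ s, m (q s) ↔ s.Holds M := fun s =>
    (hqq _ _ (Function.surjInv_eq hq (q s))).2.1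
  let K : Set A := {a | ∃ c : L.Functions 0, a ∈ M.const c}
  obtain ⟨ext, hext, hext_comp⟩ := exists_coherent_extension A
  have hslot : ∀ (g : Γ) (r : A → A → Prop), IsPartialIso M g r →
      IsSlotIso supp m K g r := by
    intro g r hr
    refine ⟨hr.biUnique, ?_, ?_⟩
    · rintro k ⟨c, hc⟩
      exact hr.const c k hc
    · intro i σ hσ hi
      obtain ⟨s, rfl⟩ := hq i
      rw [← hact, hm, hm]
      refine hr.holds_smul_iff hσ fun a ha => hi a ?_
      rwa [← Finset.mem_coe, hsuppq]
  have hholds : ∀ γ ∈ fibreSumGroup supp hsupp (indicatorZMod p m) K,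
      ∃ σ : Equiv.Perm A, (∀ a b, γ.2 (a, indicatorZMod p m) = (b, indicatorZMod p m) → σ a = b) ∧
        ∀ s : Slot L A, s.vertices.Nonempty →
          (∀ a ∈ s.vertices, γ.2 (a, indicatorZMod p m) = (σ a, indicatorZMod p m)) →
          (((γ.1, σ) • s).Holds M ↔ s.Holds M) := by
    rintro γ ⟨σ, h1, -, h2⟩
    refine ⟨σ, fun a b hab => ?_, fun s hne hs => ?_⟩
    · rw [← h1 (a, indicatorZMod p m), hab]
    · rw [← hm, ← hm, hact]
      refine mark_iff_of_mem_fibreSumGroup (by omega) ?_ (fun a ha => hs a ?_) h2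
      · rwa [← Finset.coe_nonempty, hsuppq]
      · rwa [← hsuppq]
  refine ⟨A × (Fin n → ZMod p), inferInstance, ⟨{
    grp := fibreSumGroup supp hsupp (indicatorZMod p m) K
    emb := fun a => (a, indicatorZMod p m)
    emb_injective := fun a b h => congrArg Prod.fst h
    rel := ?_
    func := ?_
    const := ?_
    lift := fun g r => twistedPerm g (ext r) (balancingShift p supp m g (ext r) (relRange r))
    lift_mem := fun g r hr =>
      twistedPerm_mem_fibreSumGroup hsupp (by omega) (hslot g r hr) (hext r hr.biUnique)
    lift_apply := fun g r hr a b hab => twistedPerm_apply_of_rel (hext r hr.biUnique) hab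
    lift_comp := ?_ }⟩⟩
  · intro γ hγ k R x y hxy hx
    obtain ⟨σ, h1, h2⟩ := hholds γ hγ
    have hσ : ∀ i, σ (x i) = y i := fun i => h1 _ _ (hxy i)
    -- A nullary relation would have empty support, and empty sums carry no information.
    have hk : k ≠ 0 := by
      rintro rfl
      exact hRel.elim R
    have := (h2 (Slot.rel R x) ⟨x ⟨0, by omega⟩, ⟨_, rfl⟩⟩ (by
      rintro _ ⟨i, rfl⟩
      rw [hxy, hσ])).2 hx
    have hy : σ ∘ x = y := funext hσ
    rw [← hy]
    exact this
  · intro γ hγ F a b S hab hS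
    obtain ⟨σ, h1, h2⟩ := hholds γ hγ
    have hF : ∀ c ∈ M.func F ![a], γ.2 (c, indicatorZMod p m) = (σ c, indicatorZMod p m) := by
      intro c hc
      have : γ.2 (c, indicatorZMod p m) ∈ (fun a => (a, indicatorZMod p m)) '' S := by
        rw [← hS]
        exact ⟨_, ⟨c, hc, rfl⟩, rfl⟩
      obtain ⟨d, -, hd⟩ := this
      rw [h1 c d hd.symm]
      exact hd.symm
    have := (h2 (Slot.func F a (M.func F ![a])) ⟨a, Set.mem_insert _ _⟩ (by
      rintro c (rfl | hc)
      · rw [hab, h1 _ _ hab]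
      · exact hF c hc)).2 rfl
    have e : σ '' M.func F ![a] = S := by
      ext d
      constructor
      · rintro ⟨c, hc, rfl⟩
        have : γ.2 (c, indicatorZMod p m) ∈ (fun a => (a, indicatorZMod p m)) '' S := by
          rw [← hS]
          exact ⟨_, ⟨c, hc, rfl⟩, rfl⟩
        obtain ⟨d, hd, hd'⟩ := this
        rwa [h1 c d hd'.symm]
      · intro hd
        have : (d, indicatorZMod p m) ∈
            γ.2 '' ((fun a => (a, indicatorZMod p m)) '' M.func F ![a]) := by
          rw [hS]
          exact ⟨d, hd, rfl⟩
        obtain ⟨_, ⟨c, hc, rfl⟩, hc'⟩ := this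
        exact ⟨c, hc, h1 _ _ hc'⟩
    rw [← e, ← h1 _ _ hab]
    exact this
  · rintro γ ⟨σ, -, h, -⟩ c a ha
    exact h a ⟨c, ha⟩
  · intro g r g' r' hr hr' hrr
    simp only [hext_comp r r' hr.biUnique hr'.biUnique hrr]
    exact twistedPerm_comp hsupp (hext r' hr'.biUnique) hrr

end Slots

/-! ### Colouring bad sets to reach two-determinacy. -/

/-- A coherent extension of partial bijections to permutations. -/
noncomputable def coherentExt (α : Type*) [Finite α] : (α → α → Prop) → Equiv.Perm α :=
  (exists_coherent_extension α).choose

theorem coherentExt_apply {α : Type*} [Finite α] {r : α → α → Prop} (hr : BiUnique r) {x y : α}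
    (h : r x y) : coherentExt α r x = y :=
  (exists_coherent_extension α).choose_spec.1 r hr x y h

theorem coherentExt_comp {α : Type*} [Finite α] {r s : α → α → Prop} (hr : BiUnique r)
    (hs : BiUnique s) (h : ∀ y, (∃ x, r x y) ↔ ∃ z, s y z) :
    coherentExt α (Relation.Comp r s) = coherentExt α s * coherentExt α r :=
  (exists_coherent_extension α).choose_spec.2 r s hr hs h

namespace ExtensionSystem

variable {L : FirstOrder.Language.{u, v}} {A : Type w} {Γ : Subgroup (LangPerm L)} {M : GStr L A}
  {X : Type w'}

/-- The group maps the set `C` into the vertex set of `M`. -/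
def MapsIn (S : ExtensionSystem Γ M X) (C : Set X) : Prop :=
  ∃ γ ∈ S.grp, ∀ x ∈ C, γ.2 x ∈ Set.range S.emb

/-- A set can be mapped into the vertex set of `M` as soon as each two of its elements can. -/
def IsTwoDetermined (S : ExtensionSystem Γ M X) : Prop :=
  ∀ C : Set X, (∀ x ∈ C, ∀ y ∈ C, S.MapsIn {x, y}) → S.MapsIn C

/-- Sets of `k + 2` elements, none of them a constant, which cannot be mapped into the vertex set
of `M`. -/
structure Bad (S : ExtensionSystem Γ M X) (k : ℕ) (U : Set X) : Prop where
  ncard_eq : U.ncard = k + 2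
  const : ∀ c : L.Functions 0, ∀ a ∈ M.const c, S.emb a ∉ U
  not_mapsIn : ¬ S.MapsIn U

theorem bad_preimage (S : ExtensionSystem Γ M X) {γ : Γ × Equiv.Perm X} (hγ : γ ∈ S.grp) {k : ℕ}
    {U : Set X} : S.Bad k (γ.2 ⁻¹' U) ↔ S.Bad k U := by
  have key : ∀ γ ∈ S.grp, ∀ U, S.Bad k U → S.Bad k (γ.2 ⁻¹' U) := by
    intro γ hγ U hU
    refine ⟨?_, fun c a ha => ?_, ?_⟩
    · rw [← hU.ncard_eq]
      exact Set.ncard_preimage_of_injective_subset_range γ.2.injective (by simp)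
    · rw [Set.mem_preimage, S.const γ hγ c a ha]
      exact hU.const c a ha
    · rintro ⟨δ, hδ, h⟩
      refine hU.not_mapsIn ⟨δ * γ⁻¹, S.grp.mul_mem hδ (S.grp.inv_mem hγ), fun x hx => ?_⟩
      exact h _ (by simpa using hx)
  refine ⟨fun h => ?_, key γ hγ U⟩
  have := key γ⁻¹ (S.grp.inv_mem hγ) _ h
  rwa [← Set.preimage_comp, show γ.2 ∘ (γ⁻¹).2 = id by ext; simp, Set.preimage_id] at this

/-- The identity shows that a bad set is not inside `M`, so at most `k + 1` of its `k + 2` elements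
are vertices of `M`. -/
theorem exists_colouring [Finite X] (S : ExtensionSystem Γ M X) (k : ℕ) (U : Set X) :
    ∃ col : A → Fin (k + 1), (S.Bad k U → Set.InjOn col {a | S.emb a ∈ U}) ∧
      ∀ a, ¬ (S.Bad k U ∧ S.emb a ∈ U) → col a = 0 := by
  classical
  by_cases hU : S.Bad k U
  · have hfin : Finite A := Finite.of_injective _ S.emb_injective
    have hlt : (S.emb '' {a | S.emb a ∈ U}).ncard < U.ncard := by
      refine Set.ncard_lt_ncard ⟨?_, fun h => hU.not_mapsIn ⟨1, S.grp.one_mem, fun x hx => ?_⟩⟩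
      · rintro _ ⟨a, ha, rfl⟩
        exact ha
      · obtain ⟨a, -, rfl⟩ := h hx
        exact ⟨a, rfl⟩
    rw [Set.ncard_image_of_injective _ S.emb_injective, hU.ncard_eq] at hlt
    let e := Finite.equivFin {a | S.emb a ∈ U}
    have hcard : Nat.card {a | S.emb a ∈ U} ≤ k + 1 := by
      rw [Nat.card_coe_set_eq]
      omega
    refine ⟨fun a => if h : S.emb a ∈ U then Fin.castLE hcard (e ⟨a, h⟩) else 0, fun _ => ?_, ?_⟩
    · intro a ha b hb hab
      simp only [Set.mem_ofPred_eq] at ha hb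
      simp only [ha, hb, dif_pos, Fin.castLE_inj, EmbeddingLike.apply_eq_iff_eq,
        Subtype.mk.injEq] at hab
      exact hab
    · intro a ha
      exact dif_neg fun h => ha ⟨hU, h⟩
  · exact ⟨fun _ => 0, fun h => absurd h hU, fun _ _ => rfl⟩

/-- A colouring of each bad set with one colour less than it has elements, such that the
vertices of `M` have distinct colours. -/
noncomputable def colour [Finite X] (S : ExtensionSystem Γ M X) (a : A) (k : ℕ) (U : Set X) :
    Fin (k + 1) :=
  (S.exists_colouring k U).choose a

theorem colour_injOn [Finite X] (S : ExtensionSystem Γ M X) {k : ℕ} {U : Set X} (hU : S.Bad k U)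
    {a b : A} (ha : S.emb a ∈ U) (hb : S.emb b ∈ U) (h : S.colour a k U = S.colour b k U) :
    a = b :=
  (S.exists_colouring k U).choose_spec.1 hU ha hb h

theorem colour_eq_zero [Finite X] (S : ExtensionSystem Γ M X) {k : ℕ} {U : Set X} {a : A}
    (h : ¬ (S.Bad k U ∧ S.emb a ∈ U)) : S.colour a k U = 0 :=
  (S.exists_colouring k U).choose_spec.2 a h

/-- Points of `X` together with a colour for each set. -/
abbrev Coloured (X : Type w') : Type w' :=
  -- Bad sets have `k + 2 ≤ |X|` elements, so the indices `k < |X|` suffice.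
  X × (∀ k : Fin (Nat.card X), Set X → Fin ((k : ℕ) + 1))

/-- The embedding of the vertices of `M` into the coloured points. -/
noncomputable def embColoured [Finite X] (S : ExtensionSystem Γ M X) (a : A) : Coloured X :=
  (S.emb a, fun k U => S.colour a k U)

/-- Only the bad sets which contain the point have a nonzero colour. -/
def Normal (S : ExtensionSystem Γ M X) (u : Coloured X) : Prop :=
  ∀ (k : Fin (Nat.card X)) (U : Set X), ¬ (S.Bad k U ∧ u.1 ∈ U) → u.2 k U = 0

/-- Two coloured points are generic if their colours at bad sets are distinct. -/
structure Generic (S : ExtensionSystem Γ M X) (u v : Coloured X) : Prop where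
  normal_left : S.Normal u
  normal_right : S.Normal v
  eq : u.1 = v.1 → u = v
  colour_ne : ∀ (k : Fin (Nat.card X)) (U : Set X), S.Bad k U → u.1 ∈ U → v.1 ∈ U → u.1 ≠ v.1 →
    u.2 k U ≠ v.2 k U

theorem generic_embColoured [Finite X] (S : ExtensionSystem Γ M X) (a b : A) :
    S.Generic (S.embColoured a) (S.embColoured b) where
  normal_left _ _ h := S.colour_eq_zero h
  normal_right _ _ h := S.colour_eq_zero h
  eq h := by rw [S.emb_injective h]
  colour_ne _ _ hU ha hb hab h := hab (congrArg S.emb (S.colour_injOn hU ha hb h))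

/-- The permutations of the coloured points over an element of the group which preserve
genericity and fix the constants. -/
noncomputable def colouredGrp [Finite X] (S : ExtensionSystem Γ M X) :
    Subgroup (Γ × Equiv.Perm (Coloured X)) where
  carrier := {γ | ∃ σ : Equiv.Perm X, (γ.1, σ) ∈ S.grp ∧ (∀ v, (γ.2 v).1 = σ v.1) ∧
    (∀ u v, S.Generic (γ.2 u) (γ.2 v) ↔ S.Generic u v) ∧
    ∀ c : L.Functions 0, ∀ a ∈ M.const c, γ.2 (S.embColoured a) = S.embColoured a}
  one_mem' := ⟨1, S.grp.one_mem, fun _ => rfl, fun _ _ => Iff.rfl, fun _ _ _ => rfl⟩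
  mul_mem' := by
    rintro ⟨g, β⟩ ⟨g', β'⟩ ⟨σ, h0, h1, h2, h3⟩ ⟨σ', h0', h1', h2', h3'⟩
    refine ⟨σ * σ', S.grp.mul_mem h0 h0', fun v => ?_, fun u v => ?_, fun c a ha => ?_⟩
    · exact (h1 (β' v)).trans (congrArg σ (h1' v))
    · exact (h2 _ _).trans (h2' _ _)
    · exact (congrArg β (h3' c a ha)).trans (h3 c a ha)
  inv_mem' := by
    rintro ⟨g, β⟩ ⟨σ, h0, h1, h2, h3⟩
    refine ⟨σ⁻¹, S.grp.inv_mem h0, fun v => ?_, fun u v => ?_, fun c a ha => ?_⟩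
    · rw [Equiv.Perm.eq_inv_iff_eq, ← h1]
      exact congrArg Prod.fst (β.apply_symm_apply v)
    · refine (h2 _ _).symm.trans ?_
      change S.Generic (β (β.symm u)) (β (β.symm v)) ↔ _
      rw [β.apply_symm_apply, β.apply_symm_apply]
    · exact β.symm_apply_eq.2 (h3 c a ha).symm

/-- The colour changes at `U` which are needed for mapping `v` to `a` whenever `T v a`. -/
def colourRel [Finite X] (S : ExtensionSystem Γ M X) (σ : Equiv.Perm X) (T : Coloured X → A → Prop)
    (k : Fin (Nat.card X)) (U : Set X) (c d : Fin ((k : ℕ) + 1)) : Prop :=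
  ∃ v a, T v a ∧ S.emb a ∈ U ∧ c = v.2 k (σ ⁻¹' U) ∧ d = S.colour a k U

open Classical in
/-- The permutation of the colours at `U`. -/
noncomputable def colourPerm [Finite X] (S : ExtensionSystem Γ M X) (σ : Equiv.Perm X)
    (T : Coloured X → A → Prop) (k : Fin (Nat.card X)) (U : Set X) (x : X) :
    Equiv.Perm (Fin ((k : ℕ) + 1)) :=
  if S.Bad k U ∧ x ∈ U then coherentExt _ (S.colourRel σ T k U) else 1

/-- The permutation `σ` acting on points, followed by a permutation of the colours at each bad
set. -/
noncomputable def recolour [Finite X] (S : ExtensionSystem Γ M X) (σ : Equiv.Perm X)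
    (T : Coloured X → A → Prop) : Equiv.Perm (Coloured X) where
  toFun v := (σ v.1, fun k U => S.colourPerm σ T k U (σ v.1) (v.2 k (σ ⁻¹' U)))
  invFun v := (σ.symm v.1, fun k U =>
    (S.colourPerm σ T k (σ.symm ⁻¹' U) v.1).symm (v.2 k (σ.symm ⁻¹' U)))
  left_inv v := by
    refine Prod.ext (by simp) ?_
    funext k U
    simp [← Set.preimage_comp]
  right_inv v := by
    refine Prod.ext (by simp) ?_
    funext k U
    simp [← Set.preimage_comp]

section recolour

variable [Finite X] (S : ExtensionSystem Γ M X) {g : Γ} {σ : Equiv.Perm X}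
  {T : Coloured X → A → Prop}

theorem recolour_fst (v : Coloured X) : (S.recolour σ T v).1 = σ v.1 := rfl

theorem recolour_snd (v : Coloured X) (k : Fin (Nat.card X)) (U : Set X) :
    (S.recolour σ T v).2 k U = S.colourPerm σ T k U (σ v.1) (v.2 k (σ ⁻¹' U)) := rfl

theorem colourPerm_of_not {k : Fin (Nat.card X)} {U : Set X} {x : X} (h : ¬ (S.Bad k U ∧ x ∈ U)) :
    S.colourPerm σ T k U x = 1 := if_neg h

theorem colourPerm_of_bad {k : Fin (Nat.card X)} {U : Set X} {x : X} (h : S.Bad k U) (hx : x ∈ U) :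
    S.colourPerm σ T k U x = coherentExt _ (S.colourRel σ T k U) := if_pos ⟨h, hx⟩

/-- Target colours are distinct because vertices of `M` are coloured injectively; source colours are
distinct by genericity at the preimage of `U`, which is again bad. -/
theorem biUnique_colourRel (hσ : (g, σ) ∈ S.grp) (hT : ∀ v a, T v a → σ v.1 = S.emb a)
    (hTg : ∀ v a v' a', T v a → T v' a' → S.Generic v v') {k : Fin (Nat.card X)} {U : Set X}
    (hU : S.Bad k U) : BiUnique (S.colourRel σ T k U) := by
  constructor
  · rintro c c' d ⟨v, a, hva, ha, rfl, rfl⟩ ⟨v', a', hva', ha', rfl, h⟩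
    obtain rfl := S.colour_injOn hU ha ha' h
    rw [(hTg _ _ _ _ hva hva').eq (σ.injective ((hT _ _ hva).trans (hT _ _ hva').symm))]
  · rintro c d d' ⟨v, a, hva, ha, rfl, rfl⟩ ⟨v', a', hva', ha', h, rfl⟩
    by_cases hv : v.1 = v'.1
    · rw [S.emb_injective ((hT _ _ hva).symm.trans ((congrArg σ hv).trans (hT _ _ hva')))]
    · refine absurd h ((hTg _ _ _ _ hva hva').colour_ne k _ ((S.bad_preimage hσ).2 hU) ?_ ?_ hv)
      · rwa [Set.mem_preimage, hT _ _ hva]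
      · rwa [Set.mem_preimage, hT _ _ hva']

theorem recolour_apply (hσ : (g, σ) ∈ S.grp) (hT : ∀ v a, T v a → σ v.1 = S.emb a)
    (hTg : ∀ v a v' a', T v a → T v' a' → S.Generic v v') {v : Coloured X} {a : A} (h : T v a) :
    S.recolour σ T v = S.embColoured a := by
  refine Prod.ext (hT v a h) ?_
  funext k U
  rw [recolour_snd, hT v a h]
  by_cases hU : S.Bad k U ∧ S.emb a ∈ U
  · rw [S.colourPerm_of_bad hU.1 hU.2]
    exact coherentExt_apply (S.biUnique_colourRel hσ hT hTg hU.1) ⟨v, a, h, hU.2, rfl, rfl⟩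
  · rw [S.colourPerm_of_not hU, Equiv.Perm.one_apply]
    change _ = S.colour a k U
    rw [S.colour_eq_zero hU]
    refine (hTg v a v a h h).normal_left k _ ?_
    rwa [S.bad_preimage hσ, Set.mem_preimage, hT v a h]

theorem normal_recolour (hσ : (g, σ) ∈ S.grp) (u : Coloured X) :
    S.Normal (S.recolour σ T u) ↔ S.Normal u := by
  unfold Normal
  refine forall_congr' fun k => ?_
  rw [(Set.preimage_surjective.2 σ.injective).forall
    (p := fun U => ¬ (S.Bad k U ∧ u.1 ∈ U) → u.2 k U = 0)]
  refine forall_congr' fun U => ?_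
  rw [S.bad_preimage hσ, Set.mem_preimage, recolour_fst, recolour_snd]
  refine imp_congr_right fun h => ?_
  rw [S.colourPerm_of_not h, Equiv.Perm.one_apply]

/-- All points of a bad set have their colours at it changed by the same permutation, so
distinctness is kept. -/
theorem generic_recolour (hσ : (g, σ) ∈ S.grp) (u v : Coloured X) :
    S.Generic (S.recolour σ T u) (S.recolour σ T v) ↔ S.Generic u v := by
  have key : (∀ (k : Fin (Nat.card X)) (U : Set X), S.Bad k U → (S.recolour σ T u).1 ∈ U →
      (S.recolour σ T v).1 ∈ U → (S.recolour σ T u).1 ≠ (S.recolour σ T v).1 →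
      (S.recolour σ T u).2 k U ≠ (S.recolour σ T v).2 k U) ↔
      ∀ (k : Fin (Nat.card X)) (U : Set X), S.Bad k U → u.1 ∈ U → v.1 ∈ U → u.1 ≠ v.1 →
        u.2 k U ≠ v.2 k U := by
    refine forall_congr' fun k => ?_
    rw [(Set.preimage_surjective.2 σ.injective).forall (p := fun U => S.Bad k U → u.1 ∈ U →
      v.1 ∈ U → u.1 ≠ v.1 → u.2 k U ≠ v.2 k U)]
    refine forall_congr' fun U => ?_
    rw [S.bad_preimage hσ, Set.mem_preimage, Set.mem_preimage, recolour_fst, recolour_fst,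
      recolour_snd, recolour_snd, σ.injective.ne_iff]
    refine imp_congr_right fun h => imp_congr_right fun hu => imp_congr_right fun hv => ?_
    rw [S.colourPerm_of_bad h hu, S.colourPerm_of_bad h hv, (Equiv.injective _).ne_iff]
  have heq : ((S.recolour σ T u).1 = (S.recolour σ T v).1 → S.recolour σ T u = S.recolour σ T v) ↔
      (u.1 = v.1 → u = v) := by
    rw [recolour_fst, recolour_fst, σ.injective.eq_iff, (Equiv.injective _).eq_iff]
  constructor
  · rintro ⟨h1, h2, h3, h4⟩
    exact ⟨(S.normal_recolour hσ u).1 h1, (S.normal_recolour hσ v).1 h2, heq.1 h3, key.1 h4⟩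
  · rintro ⟨h1, h2, h3, h4⟩
    exact ⟨(S.normal_recolour hσ u).2 h1, (S.normal_recolour hσ v).2 h2, heq.2 h3, key.2 h4⟩

/-- Constants lie in no bad set: their colours are all `0` and are never permuted. -/
theorem recolour_mem (hσ : (g, σ) ∈ S.grp) : (g, S.recolour σ T) ∈ S.colouredGrp := by
  refine ⟨σ, hσ, fun _ => rfl, S.generic_recolour hσ, fun c a ha => ?_⟩
  have hσa : σ (S.emb a) = S.emb a := S.const _ hσ c a ha
  refine Prod.ext hσa ?_
  funext k U
  have h : ¬ (S.Bad k U ∧ S.emb a ∈ U) := fun h => h.1.const c a ha h.2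
  have h' : ¬ (S.Bad k (σ ⁻¹' U) ∧ S.emb a ∈ σ ⁻¹' U) := fun h => h.1.const c a ha h.2
  rw [recolour_snd]
  simp only [embColoured]
  rw [hσa, S.colourPerm_of_not h, Equiv.Perm.one_apply, S.colour_eq_zero h, S.colour_eq_zero h']

/-- Coloured vertices are mapped according to `r`. -/
def colouredRel (r : A → A → Prop) (v : Coloured X) (b : A) : Prop :=
  ∃ a, v = S.embColoured a ∧ r a b

theorem colouredRel_fst {r : A → A → Prop}
    (hr : ∀ a b, r a b → σ (S.emb a) = S.emb b) :
    ∀ v a, S.colouredRel r v a → σ v.1 = S.emb a := by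
  rintro _ b ⟨a, rfl, hab⟩
  exact hr a b hab

theorem colouredRel_generic {r : A → A → Prop} :
    ∀ v a v' a', S.colouredRel r v a → S.colouredRel r v' a' → S.Generic v v' := by
  rintro _ b _ b' ⟨a, rfl, -⟩ ⟨a', rfl, -⟩
  exact S.generic_embColoured a a'

/-- At a bad set the colour relations compose, since a colour determines the intermediate vertex of
`M`. Coherence of `coherentExt` then applies. -/
theorem recolour_comp {g' : Γ} {σ' : Equiv.Perm X} (hσ : (g, σ) ∈ S.grp) (hσ' : (g', σ') ∈ S.grp)
    {r r' : A → A → Prop} (hr : ∀ a b, r a b → σ (S.emb a) = S.emb b)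
    (hr' : ∀ a b, r' a b → σ' (S.emb a) = S.emb b) (hrr : ∀ y, (∃ x, r x y) ↔ ∃ z, r' y z) :
    S.recolour (σ' * σ) (S.colouredRel (Relation.Comp r r')) =
      S.recolour σ' (S.colouredRel r') * S.recolour σ (S.colouredRel r) := by
  ext1 v
  refine Prod.ext rfl ?_
  funext k U
  rw [Equiv.Perm.mul_apply, recolour_snd, recolour_snd, recolour_snd, recolour_fst]
  have hU' : S.Bad k (σ' ⁻¹' U) ↔ S.Bad k U := S.bad_preimage hσ'
  by_cases h : S.Bad k U ∧ σ' (σ v.1) ∈ U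
  · rw [Equiv.Perm.mul_apply, S.colourPerm_of_bad h.1 h.2, S.colourPerm_of_bad h.1 h.2,
      S.colourPerm_of_bad (hU'.2 h.1) h.2, ← Equiv.Perm.mul_apply, ← coherentExt_comp]
    · congr 2
      ext c d
      constructor
      · rintro ⟨_, a, ⟨a₀, rfl, b, hb, hb'⟩, ha, rfl, rfl⟩
        exact ⟨S.colour b k (σ' ⁻¹' U), ⟨_, b, ⟨a₀, rfl, hb⟩, by
          rwa [Set.mem_preimage, hr' _ _ hb'], rfl, rfl⟩, ⟨_, a, ⟨b, rfl, hb'⟩, ha, rfl, rfl⟩⟩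
      · rintro ⟨e, ⟨_, b, ⟨a₀, rfl, hb⟩, hbU, rfl, rfl⟩, ⟨_, a, ⟨b', rfl, hb'⟩, ha, h1, rfl⟩⟩
        obtain rfl := S.colour_injOn (hU'.2 h.1) hbU (by rwa [Set.mem_preimage, hr' _ _ hb']) h1
        exact ⟨_, a, ⟨a₀, rfl, b, hb, hb'⟩, ha, rfl, rfl⟩
    · exact S.biUnique_colourRel hσ (S.colouredRel_fst hr) S.colouredRel_generic (hU'.2 h.1)
    · exact S.biUnique_colourRel hσ' (S.colouredRel_fst hr') S.colouredRel_generic h.1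
    · intro e
      constructor
      · rintro ⟨_, _, b, ⟨a₀, rfl, hb⟩, hbU, rfl, rfl⟩
        obtain ⟨a, ha⟩ := (hrr b).1 ⟨a₀, hb⟩
        exact ⟨_, _, a, ⟨b, rfl, ha⟩, by rwa [← hr' _ _ ha], rfl, rfl⟩
      · rintro ⟨_, _, a, ⟨b, rfl, ha⟩, haU, rfl, rfl⟩
        obtain ⟨a₀, hb⟩ := (hrr b).2 ⟨a, ha⟩
        exact ⟨_, _, b, ⟨a₀, rfl, hb⟩, by rwa [Set.mem_preimage, hr' _ _ ha], rfl, rfl⟩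
  · have h' : ¬ (S.Bad k (σ' ⁻¹' U) ∧ σ v.1 ∈ σ' ⁻¹' U) := by rwa [hU', Set.mem_preimage]
    rw [Equiv.Perm.mul_apply, S.colourPerm_of_not h, S.colourPerm_of_not h,
      S.colourPerm_of_not h']
    rfl

end recolour

/-- The extension system on the coloured points. -/
noncomputable def coloured [Finite X] (S : ExtensionSystem Γ M X) :
    ExtensionSystem Γ M (Coloured X) where
  grp := S.colouredGrp
  emb := S.embColoured
  emb_injective _ _ h := S.emb_injective (congrArg Prod.fst h)
  rel := by
    rintro γ ⟨σ, hσ, h1, -, -⟩ n R x y hxy hx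
    refine S.rel _ hσ R x y (fun i => ?_) hx
    have := congrArg Prod.fst (hxy i)
    rwa [h1] at this
  func := by
    rintro γ ⟨σ, hσ, h1, -, -⟩ F a b V hab hV
    refine S.func _ hσ F a b V ?_ ?_
    · have := congrArg Prod.fst hab
      rwa [h1] at this
    · have := congrArg (Set.image Prod.fst) hV
      simp only [Set.image_image, h1] at this ⊢
      exact this
  const := by
    rintro γ ⟨σ, -, -, -, h⟩ c a ha
    exact h c a ha
  lift g r := S.recolour (S.lift g r) (S.colouredRel r)
  lift_mem g r hr := S.recolour_mem (S.lift_mem g r hr)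
  lift_apply g r hr a b hab := S.recolour_apply (S.lift_mem g r hr)
    (S.colouredRel_fst (S.lift_apply g r hr)) S.colouredRel_generic ⟨a, rfl, hab⟩
  lift_comp g r g' r' hr hr' hrr := by
    rw [S.lift_comp g r g' r' hr hr' hrr]
    exact S.recolour_comp (S.lift_mem g r hr) (S.lift_mem g' r' hr') (S.lift_apply g r hr)
      (S.lift_apply g' r' hr') hrr

theorem isTwoDetermined_coloured [Finite X] (S : ExtensionSystem Γ M X) :
    S.coloured.IsTwoDetermined := by
  intro C hC
  have hgen : ∀ u ∈ C, ∀ v ∈ C, S.Generic u v := by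
    intro u hu v hv
    obtain ⟨γ, ⟨σ, -, -, h, -⟩, hγ⟩ := hC u hu v hv
    obtain ⟨a, ha⟩ := hγ u (by simp)
    obtain ⟨b, hb⟩ := hγ v (by simp)
    rw [← h, ← ha, ← hb]
    exact S.generic_embColoured a b
  -- Constants are left out, as in bad sets; the group fixes them anyway.
  let U : Set X := {x | (∃ u ∈ C, u.1 = x) ∧ ∀ c : L.Functions 0, ∀ a ∈ M.const c, S.emb a ≠ x}
  have hU : S.MapsIn U := by
    by_contra hmaps
    have h0 : U.ncard ≠ 0 := by
      intro h0
      rw [Set.ncard_eq_zero] at h0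
      exact hmaps ⟨1, S.grp.one_mem, by simp [h0]⟩
    -- Bad sets have at least two elements, so a single point is moved into `M` directly.
    have h1 : U.ncard ≠ 1 := by
      intro h1
      obtain ⟨x, hx⟩ := Set.ncard_eq_one.1 h1
      obtain ⟨⟨u, hu, rfl⟩, -⟩ : x ∈ U := by simp [hx]
      obtain ⟨γ, ⟨σ, hσ, h, -, -⟩, hγ⟩ := hC u hu u hu
      obtain ⟨a, ha⟩ := hγ u (by simp)
      refine hmaps ⟨_, hσ, ?_⟩
      rw [hx]
      rintro _ rfl
      refine ⟨a, ?_⟩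
      rw [← h, ← ha]
      rfl
    obtain ⟨k, hk⟩ : ∃ k, U.ncard = k + 2 := ⟨U.ncard - 2, by omega⟩
    have hbad : S.Bad k U := ⟨hk, fun c a ha h => h.2 c a ha rfl, hmaps⟩
    have hkX : k < Nat.card X := by
      have := Set.ncard_le_card U
      omega
    choose! f hf hf' using fun x (hx : x ∈ U) => hx.1
    have : U.ncard ≤ (Set.univ : Set (Fin (k + 1))).ncard := by
      refine Set.ncard_le_ncard_of_injOn (fun x => (f x).2 ⟨k, hkX⟩ U) (fun _ _ => Set.mem_univ _) ?_
      intro x hx y hy hxy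
      by_contra hne
      refine (hgen (f x) (hf x hx) (f y) (hf y hy)).colour_ne ⟨k, hkX⟩ U hbad ?_ ?_ ?_ hxy
      · rwa [hf' x hx]
      · rwa [hf' y hy]
      · rwa [hf' x hx, hf' y hy]
    rw [Set.ncard_univ, Nat.card_eq_fintype_card, Fintype.card_fin] at this
    omega
  obtain ⟨⟨g, σ⟩, hσ, hσU⟩ := hU
  have hσC : ∀ u ∈ C, ∃ a, S.emb a = σ u.1 := by
    intro u hu
    by_cases h : ∀ c : L.Functions 0, ∀ a ∈ M.const c, S.emb a ≠ u.1
    · exact hσU u.1 ⟨⟨u, hu, rfl⟩, h⟩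
    · push Not at h
      obtain ⟨c, a, ha, h⟩ := h
      refine ⟨a, ?_⟩
      rw [← h]
      exact (S.const _ hσ c a ha).symm
  -- `σ` already moves the projection of `C` into `M`; recolouring along `T` corrects the colours.
  let T : Coloured X → A → Prop := fun v a => v ∈ C ∧ σ v.1 = S.emb a
  refine ⟨(g, S.recolour σ T), S.recolour_mem hσ, fun u hu => ?_⟩
  obtain ⟨a, ha⟩ := hσC u hu
  exact ⟨a, (S.recolour_apply hσ (fun v a h => h.2)
    (fun v a v' a' h h' => hgen v h.1 v' h'.1) (⟨hu, ha.symm⟩ : T u a)).symm⟩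

end ExtensionSystem

/-! ### Closure under unary functions. -/

namespace GStr

variable {L : FirstOrder.Language.{u, v}} {A : Type w}

/-- `N.Reaches x y` means that `y` is in the closure of `x` under the unary functions of `N`. -/
def Reaches (N : GStr L A) : A → A → Prop :=
  Relation.ReflTransGen fun x y => ∃ F : L.Functions 1, y ∈ N.func F ![x]

theorem Reaches.of_mem_func {N : GStr L A} {x y : A} {F : L.Functions 1} (h : y ∈ N.func F ![x]) :
    N.Reaches x y :=
  Relation.ReflTransGen.single ⟨F, h⟩

theorem Reaches.trans {N : GStr L A} {x y z : A} (h : N.Reaches x y) (h' : N.Reaches y z) :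
    N.Reaches x z :=
  Relation.ReflTransGen.trans h h'

theorem IsClosed.mem_of_reaches {N : GStr L A} {V : Set A} (hV : N.IsClosed V) {x y : A}
    (hx : x ∈ V) (h : N.Reaches x y) : y ∈ V := by
  induction h with
  | refl => exact hx
  | tail _ h ih =>
    obtain ⟨F, hF⟩ := h
    exact hV F _ (fun i => by simpa using ih) hF

/-- The functions of the language are constants and unary functions, the constants are fixed
by `Γ` and their values in `M` are single vertices at which the unary functions are empty. -/
structure HasRigidConstants (Γ : Subgroup (LangPerm L)) (M : GStr L A) : Prop where
  isEmpty_functions : ∀ n : ℕ, 2 ≤ n → IsEmpty (L.Functions n)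
  fix : ∀ g ∈ Γ, ∀ c : L.Functions 0, g.2 0 c = c
  const_eq : ∀ c : L.Functions 0, ∃ a : A, M.const c = {a}
  func_const : ∀ (c : L.Functions 0) (F : L.Functions 1), ∀ a ∈ M.const c, M.func F ![a] = ∅

theorem HasRigidConstants.eq_of_reaches {Γ : Subgroup (LangPerm L)} {M : GStr L A}
    (hM : M.HasRigidConstants Γ) {c : L.Functions 0} {a b : A} (ha : a ∈ M.const c)
    (h : M.Reaches a b) : b = a := by
  induction h with
  | refl => rfl
  | tail _ h ih =>
    obtain ⟨F, hF⟩ := h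
    rw [ih, hM.func_const c F a ha] at hF
    exact hF.elim

end GStr

open GStr

/-! ### The witness as a union of translates of `M`. -/

namespace ExtensionSystem

variable {L : FirstOrder.Language.{u, v}} {A : Type w} {Γ : Subgroup (LangPerm L)} {M : GStr L A}
  {X : Type w'} (S : ExtensionSystem Γ M X)

instance : MulAction S.grp X :=
  MulAction.compHom X ((MonoidHom.snd Γ (Equiv.Perm X)).comp S.grp.subtype)

/-- The language part of an element of the group. -/
def lang (γ : S.grp) : LangPerm L := (γ.1.1 : Γ)

theorem lang_mem (γ : S.grp) : S.lang γ ∈ Γ := (γ.1.1 : Γ).2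

open Pointwise

/-- A vertex together with its closure under the unary functions. -/
def germ (a : A) : X × Set X := (S.emb a, S.emb '' {b | M.Reaches a b})

/-- The vertices of the witness: the translates of germs. -/
def Vertex : Type w' := {p : X × Set X // ∃ (γ : S.grp) (a : A), p = γ • S.germ a}

instance : MulAction S.grp S.Vertex where
  smul γ p := ⟨γ • p.1, by
    obtain ⟨δ, a, h⟩ := p.2
    exact ⟨γ * δ, a, by rw [h, mul_smul]⟩⟩
  one_smul p := Subtype.ext (one_smul _ p.1)
  mul_smul γ δ p := Subtype.ext (mul_smul γ δ p.1)

instance [Finite X] : Finite S.Vertex := Subtype.finite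

/-- The vertex of the witness which corresponds to a vertex of `M`. -/
def point (a : A) : S.Vertex := ⟨S.germ a, 1, a, (one_smul _ _).symm⟩

theorem point_injective : Function.Injective S.point := fun _ _ h =>
  S.emb_injective (congrArg (fun p => p.1.1) h)

theorem exists_eq_smul_point (p : S.Vertex) : ∃ (γ : S.grp) (a : A), p = γ • S.point a := by
  obtain ⟨γ, a, h⟩ := p.2
  exact ⟨γ, a, Subtype.ext h⟩

variable {S}

theorem emb_of_smul_point {γ : S.grp} {a b : A} (h : γ • S.point a = S.point b) :
    γ • S.emb a = S.emb b :=
  congrArg (fun p => p.1.1) h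

/-- The second component of a germ forces the closure of `a` to move into `M` along with `a`; this
is why vertices are germs. -/
theorem mem_range_of_smul_point {γ : S.grp} {a b c : A} (h : γ • S.point a = S.point b)
    (hc : M.Reaches a c) : ∃ d, γ • S.emb c = S.emb d := by
  have h' : γ • (S.emb '' {b | M.Reaches a b}) = S.emb '' {c | M.Reaches b c} :=
    congrArg (fun p => p.1.2) h
  have : γ • S.emb c ∈ S.emb '' {c | M.Reaches b c} := by
    rw [← h']
    exact Set.smul_mem_smul_set ⟨c, hc, rfl⟩
  obtain ⟨d, -, hd⟩ := this
  exact ⟨d, hd.symm⟩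

theorem mem_func_iff {γ : S.grp} {a b : A} (h : γ • S.emb a = S.emb b) {F : L.Functions 1}
    (hF : ∀ c ∈ M.func F ![a], ∃ d, γ • S.emb c = S.emb d) (d : A) :
    d ∈ M.func ((S.lang γ).2 1 F) ![b] ↔ ∃ c ∈ M.func F ![a], γ • S.emb c = S.emb d := by
  have := S.func γ.1 γ.2 F a b {d | ∃ c ∈ M.func F ![a], γ • S.emb c = S.emb d} h (by
    ext x
    constructor
    · rintro ⟨_, ⟨c, hc, rfl⟩, rfl⟩
      obtain ⟨d, hd⟩ := hF c hc
      exact ⟨d, ⟨c, hc, hd⟩, hd.symm⟩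
    · rintro ⟨d, ⟨c, hc, hd⟩, rfl⟩
      exact ⟨_, ⟨c, hc, rfl⟩, hd⟩)
  change d ∈ M.func (γ.1.1.1.2 1 F) ![b] ↔ _
  rw [this]
  rfl

/-- Induction along reachability matches the two closures; the converse direction uses that the
language part is surjective on unary symbols. -/
theorem smul_point_of_emb {γ : S.grp} {a b : A} (h : γ • S.emb a = S.emb b)
    (hr : ∀ c, M.Reaches a c → ∃ d, γ • S.emb c = S.emb d) : γ • S.point a = S.point b := by
  have h1 : ∀ c, M.Reaches a c → ∃ d, M.Reaches b d ∧ γ • S.emb c = S.emb d := by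
    intro c hc
    induction hc with
    | refl => exact ⟨b, Relation.ReflTransGen.refl, h⟩
    | tail hac hF ih =>
      obtain ⟨F, hF⟩ := hF
      obtain ⟨d, hd, hcd⟩ := ih
      obtain ⟨d', hd'⟩ := hr _ (Relation.ReflTransGen.tail hac ⟨F, hF⟩)
      refine ⟨d', Relation.ReflTransGen.tail hd ⟨(S.lang γ).2 1 F, ?_⟩, hd'⟩
      rw [mem_func_iff hcd (fun e he => hr e (Relation.ReflTransGen.tail hac ⟨F, he⟩))]
      exact ⟨_, hF, hd'⟩
  have h2 : ∀ d, M.Reaches b d → ∃ c, M.Reaches a c ∧ γ • S.emb c = S.emb d := by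
    intro d hd
    induction hd with
    | refl => exact ⟨a, Relation.ReflTransGen.refl, h⟩
    | tail hbd hF ih =>
      obtain ⟨F, hF⟩ := hF
      obtain ⟨c, hc, hcd⟩ := ih
      obtain ⟨F, rfl⟩ := ((S.lang γ).2 1).surjective F
      rw [mem_func_iff hcd (fun e he => hr e (Relation.ReflTransGen.tail hc ⟨F, he⟩))] at hF
      obtain ⟨c', hc', h'⟩ := hF
      exact ⟨c', Relation.ReflTransGen.tail hc ⟨F, hc'⟩, h'⟩
  refine Subtype.ext (Prod.ext h ?_)
  change γ • (S.emb '' {b | M.Reaches a b}) = S.emb '' {c | M.Reaches b c}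
  ext x
  rw [Set.mem_smul_set]
  constructor
  · rintro ⟨_, ⟨c, hc, rfl⟩, rfl⟩
    obtain ⟨d, hd, hcd⟩ := h1 c hc
    exact ⟨d, hd, hcd.symm⟩
  · rintro ⟨d, hd, rfl⟩
    obtain ⟨c, hc, hcd⟩ := h2 d hd
    exact ⟨_, ⟨c, hc, rfl⟩, hcd⟩

theorem exists_smul_point_eq {γ : S.grp} {a b c : A} (h : γ • S.point a = S.point b)
    (hc : M.Reaches a c) : ∃ d, γ • S.point c = S.point d := by
  obtain ⟨d, hd⟩ := mem_range_of_smul_point h hc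
  exact ⟨d, smul_point_of_emb hd fun e he => mem_range_of_smul_point h (hc.trans he)⟩

theorem smul_point_const (hM : M.HasRigidConstants Γ) (γ : S.grp) {c : L.Functions 0} {a : A}
    (ha : a ∈ M.const c) : γ • S.point a = S.point a := by
  have h : γ • S.emb a = S.emb a := S.const γ.1 γ.2 c a ha
  refine smul_point_of_emb h fun b hb => ⟨a, ?_⟩
  rw [hM.eq_of_reaches ha hb, h]

variable (S)

/-- The union of the translates of `M`. -/
def witness : GStr L S.Vertex where
  rel {n} R := {z | ∃ (γ : S.grp) (R₀ : L.Relations n) (x : Fin n → A), x ∈ M.rel R₀ ∧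
    (S.lang γ).1 n R₀ = R ∧ z = fun i => γ • S.point (x i)}
  func {n} F z := {w | ∃ (γ : S.grp) (F₀ : L.Functions n) (x : Fin n → A), ∃ b ∈ M.func F₀ x,
    (S.lang γ).2 n F₀ = F ∧ (z = fun i => γ • S.point (x i)) ∧ w = γ • S.point b}

theorem smul_mem_rel_witness (δ : S.grp) {n : ℕ} {R : L.Relations n} {z : Fin n → S.Vertex}
    (h : z ∈ S.witness.rel R) : (fun i => δ • z i) ∈ S.witness.rel ((S.lang δ).1 n R) := by
  obtain ⟨γ, R₀, x, hx, rfl, rfl⟩ := h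
  exact ⟨δ * γ, R₀, x, hx, rfl, by simp only [mul_smul]⟩

theorem smul_mem_func_witness (δ : S.grp) {n : ℕ} {F : L.Functions n} {z : Fin n → S.Vertex}
    {w : S.Vertex} (h : w ∈ S.witness.func F z) :
    δ • w ∈ S.witness.func ((S.lang δ).2 n F) (fun i => δ • z i) := by
  obtain ⟨γ, F₀, x, b, hb, rfl, rfl, rfl⟩ := h
  exact ⟨δ * γ, F₀, x, b, hb, rfl, by simp only [mul_smul], by rw [mul_smul]⟩

theorem lang_inv_fst (δ : S.grp) {n : ℕ} (R : L.Relations n) :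
    (S.lang δ⁻¹).1 n ((S.lang δ).1 n R) = R :=
  ((S.lang δ).1 n).symm_apply_apply R

theorem lang_inv_snd (δ : S.grp) {n : ℕ} (F : L.Functions n) :
    (S.lang δ⁻¹).2 n ((S.lang δ).2 n F) = F :=
  ((S.lang δ).2 n).symm_apply_apply F

/-- Group elements act on the witness by automorphisms. -/
def aut (δ : S.grp) : Aut Γ S.witness where
  lang := S.lang δ
  lang_mem := S.lang_mem δ
  toPerm := MulAction.toPerm δ
  isEmbedding := by
    refine ⟨(MulAction.toPerm δ).injective, fun R x => ⟨S.smul_mem_rel_witness δ, fun h => ?_⟩,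
      fun F x => ?_⟩
    · have := S.smul_mem_rel_witness δ⁻¹ h
      rw [lang_inv_fst] at this
      simpa using this
    · ext w
      constructor
      · rintro ⟨w, hw, rfl⟩
        exact S.smul_mem_func_witness δ hw
      · intro hw
        have := S.smul_mem_func_witness δ⁻¹ hw
        rw [lang_inv_snd] at this
        exact ⟨δ⁻¹ • w, by simpa using this, by simp⟩

theorem point_mem_rel_iff {n : ℕ} (R : L.Relations n) (x : Fin n → A) :
    x ∈ M.rel R ↔ S.point ∘ x ∈ S.witness.rel R := by
  constructor
  · intro h
    exact ⟨1, R, x, h, rfl, by simp only [one_smul]; rfl⟩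
  · rintro ⟨γ, R₀, x₀, h₀, rfl, h⟩
    exact S.rel γ.1 γ.2 R₀ x₀ x (fun i => emb_of_smul_point (congrFun h i).symm) h₀

/-- A translate meeting `M` adds no function values there: constants are fixed, and if `γ` maps a
point of `M` to a point of `M`, it maps the whole closure into `M`. -/
theorem image_point_func (hM : M.HasRigidConstants Γ) {n : ℕ} (F : L.Functions n)
    (x : Fin n → A) : S.point '' M.func F x = S.witness.func F (S.point ∘ x) := by
  ext w
  constructor
  · rintro ⟨b, hb, rfl⟩
    exact ⟨1, F, x, b, hb, rfl, by simp only [one_smul]; rfl, by rw [one_smul]⟩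
  · rintro ⟨γ, F₀, x₀, b, hb, rfl, h, rfl⟩
    match n, F₀, x₀, x, hb, h with
    | 0, F₀, x₀, x, hb, h =>
      rw [hM.fix _ (S.lang_mem γ)]
      obtain rfl : x₀ = x := Subsingleton.elim _ _
      have hb' : b ∈ M.const F₀ := by
        rw [GStr.const, Subsingleton.elim ![] x₀]
        exact hb
      exact ⟨b, hb, (smul_point_const hM γ hb').symm⟩
    | 1, F₀, x₀, x, hb, h =>
      have e : ∀ y : Fin 1 → A, y = ![y 0] := fun y => by
        ext i
        rw [Subsingleton.elim i 0]
        rfl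
      rw [e x₀] at hb
      rw [e x]
      have h0 : γ • S.point (x₀ 0) = S.point (x 0) := (congrFun h 0).symm
      obtain ⟨d, hd⟩ := exists_smul_point_eq h0 (Reaches.of_mem_func hb)
      refine ⟨d, ?_, hd.symm⟩
      rw [mem_func_iff (emb_of_smul_point h0)
        fun c hc => mem_range_of_smul_point h0 (Reaches.of_mem_func hc)]
      exact ⟨b, hb, emb_of_smul_point hd⟩
    | n + 2, F₀, _, _, _, _ => exact (hM.isEmpty_functions (n + 2) (by omega)).elim F₀

/-- The embedding of `M` into the witness. -/
def pointEmb (hM : M.HasRigidConstants Γ) : Emb Γ M S.witness where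
  lang := 1
  lang_mem := Γ.one_mem
  toFun := S.point
  isEmbedding := ⟨S.point_injective, S.point_mem_rel_iff, S.image_point_func hM⟩

theorem image_point_func_one (hM : M.HasRigidConstants Γ) (F : L.Functions 1) (a : A) :
    S.point '' M.func F ![a] = S.witness.func F ![S.point a] := by
  rw [S.image_point_func hM]
  congr 1
  ext i
  rw [Subsingleton.elim i 0]
  rfl

theorem image_point_const (hM : M.HasRigidConstants Γ) (c : L.Functions 0) (z : Fin 0 → S.Vertex) :
    S.point '' M.const c = S.witness.func c z := by
  rw [GStr.const, S.image_point_func hM, Subsingleton.elim z]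

theorem exists_of_reaches_smul_point (hM : M.HasRigidConstants Γ) {γ : S.grp} {a : A}
    {w : S.Vertex} (h : S.witness.Reaches (γ • S.point a) w) :
    ∃ b, M.Reaches a b ∧ w = γ • S.point b := by
  induction h with
  | refl => exact ⟨a, Relation.ReflTransGen.refl, rfl⟩
  | @tail y w _ h ih =>
    obtain ⟨b, hab, rfl⟩ := ih
    obtain ⟨F, hF⟩ := h
    have := S.smul_mem_func_witness γ⁻¹ hF
    rw [show (fun i => γ⁻¹ • ![γ • S.point b] i) = ![S.point b] by
      ext1 i
      rw [Subsingleton.elim i 0]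
      simp, ← S.image_point_func_one hM] at this
    obtain ⟨d, hd, hdw⟩ := this
    exact ⟨d, hab.trans (Reaches.of_mem_func hd), by rw [hdw, smul_inv_smul]⟩

theorem reaches_smul_point (hM : M.HasRigidConstants Γ) (γ : S.grp) {a b : A}
    (h : M.Reaches a b) : S.witness.Reaches (γ • S.point a) (γ • S.point b) := by
  induction h with
  | refl => exact Relation.ReflTransGen.refl
  | @tail c d _ h ih =>
    obtain ⟨F, hF⟩ := h
    refine ih.trans (Reaches.of_mem_func (F := (S.lang γ).2 1 F) ?_)
    have h1 : S.point d ∈ S.witness.func F ![S.point c] := by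
      rw [← S.image_point_func_one hM]
      exact ⟨d, hF, rfl⟩
    have := S.smul_mem_func_witness γ h1
    rwa [show (fun i => γ • ![S.point c] i) = ![γ • S.point c] by
      ext1 i
      rw [Subsingleton.elim i 0]
      rfl] at this

end ExtensionSystem

/-! ### Coherent extension and irreducible structure faithfulness. -/

namespace ExtensionSystem

variable {L : FirstOrder.Language.{u, v}} {A : Type w} {Γ : Subgroup (LangPerm L)} {M : GStr L A}
  {X : Type w'} (S : ExtensionSystem Γ M X)

/-- The graph on `A` of a partial automorphism of the witness. -/
def graph (f : PartialAut Γ S.witness) (a b : A) : Prop :=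
  ∃ h : S.point a ∈ f.dom, (f.map ⟨S.point a, h⟩ : S.Vertex) = S.point b

/-- The language part of a partial automorphism as an element of `Γ`. -/
def langPart (f : PartialAut Γ S.witness) : Γ := ⟨f.lang, f.lang_mem⟩

variable {S}

theorem exists_graph_left {f : PartialAut Γ S.witness} (hf : f.Within (Set.range S.point)) (b : A) :
    (∃ a, S.graph f a b) ↔ S.point b ∈ f.cod := by
  constructor
  · rintro ⟨a, h, hab⟩
    rw [← hab]
    exact (f.map _).2
  · intro hb
    obtain ⟨⟨x, hx⟩, hxb⟩ := f.map.surjective ⟨_, hb⟩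
    obtain ⟨a, rfl⟩ := hf.1 hx
    exact ⟨a, hx, congrArg Subtype.val hxb⟩

theorem exists_graph_right {f : PartialAut Γ S.witness} (hf : f.Within (Set.range S.point))
    (a : A) : (∃ b, S.graph f a b) ↔ S.point a ∈ f.dom := by
  constructor
  · rintro ⟨b, h, -⟩
    exact h
  · intro ha
    obtain ⟨b, hb⟩ := hf.2 (f.map ⟨_, ha⟩).2
    exact ⟨b, ha, hb.symm⟩

theorem isPartialIso_graph (hM : M.HasRigidConstants Γ) (f : PartialAut Γ S.witness) :
    IsPartialIso M (S.langPart f) (S.graph f) where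
  biUnique := by
    constructor
    · rintro a a' b ⟨h, hb⟩ ⟨h', hb'⟩
      have := f.map.injective (Subtype.ext (hb.trans hb'.symm))
      exact S.point_injective (congrArg Subtype.val this)
    · rintro a b b' ⟨h, hb⟩ ⟨h', hb'⟩
      exact S.point_injective (hb.symm.trans hb')
  rel := by
    intro n R x y hxy
    rw [S.point_mem_rel_iff, S.point_mem_rel_iff]
    choose h hxy using hxy
    refine (f.isEmbedding.rel_iff R fun i => ⟨S.point (x i), h i⟩).trans ?_
    change (fun i => (f.map ⟨S.point (x i), h i⟩ : S.Vertex)) ∈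
      S.witness.rel (f.lang.1 n R) ↔ _
    simp only [hxy]
    rfl
  func := by
    rintro F a b ⟨h, hab⟩ a' ha'
    have h1 : S.point a' ∈ S.witness.func F ![S.point a] := by
      rw [← S.image_point_func_one hM]
      exact ⟨a', ha', rfl⟩
    have h2 : S.point a' ∈ f.dom := f.dom_closed F _ (fun i => by simpa using h) h1
    have h3 := f.isEmbedding.func_eq F fun _ => ⟨S.point a, h⟩
    have h4 : f.map ⟨S.point a', h2⟩ ∈ f.map '' (S.witness.induce f.dom).func F
        fun _ => ⟨S.point a, h⟩ := by
      refine ⟨_, ?_, rfl⟩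
      change S.point a' ∈ S.witness.func F fun _ => S.point a
      rwa [show (fun _ : Fin 1 => S.point a) = ![S.point a] by ext1 i; simp]
    rw [h3] at h4
    change (f.map ⟨S.point a', h2⟩ : S.Vertex) ∈ S.witness.func (f.lang.2 1 F)
      (fun _ => (f.map ⟨S.point a, h⟩ : S.Vertex)) at h4
    rw [hab, show (fun _ : Fin 1 => S.point b) = ![S.point b] by ext1 i; simp,
      ← S.image_point_func_one hM] at h4
    obtain ⟨b', hb', h5⟩ := h4
    exact ⟨b', hb', h2, h5.symm⟩
  func' := by
    rintro F a b ⟨h, hab⟩ b' hb'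
    have h1 : S.point b' ∈ S.witness.func (f.lang.2 1 F) ![S.point b] := by
      rw [← S.image_point_func_one hM]
      exact ⟨b', hb', rfl⟩
    have hb : S.point b ∈ f.cod := by
      rw [← hab]
      exact (f.map _).2
    have h2 : S.point b' ∈ f.cod := f.cod_closed _ _ (fun i => by simpa using hb) h1
    have h3 := f.isEmbedding.func_eq F fun _ => ⟨S.point a, h⟩
    have h4 : (⟨S.point b', h2⟩ : f.cod) ∈ (S.witness.induce f.cod).func (f.lang.2 1 F)
        (f.map ∘ fun _ => ⟨S.point a, h⟩) := by
      change S.point b' ∈ S.witness.func (f.lang.2 1 F)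
        fun _ => (f.map ⟨S.point a, h⟩ : S.Vertex)
      rwa [hab, show (fun _ : Fin 1 => S.point b) = ![S.point b] by ext1 i; simp]
    rw [← h3] at h4
    obtain ⟨⟨x, hx⟩, hx', hxb⟩ := h4
    change x ∈ S.witness.func F fun _ => S.point a at hx'
    rw [show (fun _ : Fin 1 => S.point a) = ![S.point a] by ext1 i; simp,
      ← S.image_point_func_one hM] at hx'
    obtain ⟨a', ha', rfl⟩ := hx'
    exact ⟨a', ha', hx, congrArg Subtype.val hxb⟩
  const := by
    intro c a ha
    have hc : ∀ z : Fin 0 → S.Vertex, S.witness.func c z = {S.point a} := by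
      intro z
      obtain ⟨a', ha'⟩ := hM.const_eq c
      rw [← S.image_point_const hM, ha', Set.image_singleton]
      rw [ha'] at ha
      rw [Set.mem_singleton_iff.1 ha]
    -- Substructures contain the values of constants, and the language part fixes constant symbols.
    have h1 : S.point a ∈ f.dom := f.dom_closed c ![] (fun i => i.elim0) (by rw [hc]; rfl)
    have h2 : f.map ⟨_, h1⟩ ∈ f.map '' (S.witness.induce f.dom).func c fun i => i.elim0 := by
      refine ⟨_, ?_, rfl⟩
      change S.point a ∈ S.witness.func c _
      rw [hc]
      rfl
    rw [f.isEmbedding.func_eq, hM.fix _ f.lang_mem] at h2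
    change (f.map ⟨_, h1⟩ : S.Vertex) ∈ S.witness.func c _ at h2
    rw [hc] at h2
    exact ⟨h1, h2⟩

theorem _root_.EPPA.IsPartialIso.exists_of_reaches {g : Γ} {r : A → A → Prop}
    (hr : IsPartialIso M g r) {a b c : A} (hab : r a b) (hac : M.Reaches a c) : ∃ d, r c d := by
  induction hac with
  | refl => exact ⟨b, hab⟩
  | tail _ h ih =>
    obtain ⟨d, hd⟩ := ih
    obtain ⟨F, hF⟩ := h
    obtain ⟨d', -, hd'⟩ := hr.func F _ _ hd _ hF
    exact ⟨d', hd'⟩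

theorem lift_smul_point {g : Γ} {r : A → A → Prop} (hr : IsPartialIso M g r) {a b : A}
    (hab : r a b) :
    (⟨(g, S.lift g r), S.lift_mem g r hr⟩ : S.grp) • S.point a = S.point b := by
  refine smul_point_of_emb (S.lift_apply g r hr a b hab) fun c hc => ?_
  obtain ⟨d, hd⟩ := hr.exists_of_reaches hab hc
  exact ⟨d, S.lift_apply g r hr c d hd⟩

variable (S)

theorem isCoherentEPPAWitness (hM : M.HasRigidConstants Γ) :
    IsCoherentEPPAWitness (S.pointEmb hM) := by
  refine ⟨fun f => S.aut ⟨(S.langPart f.1, S.lift (S.langPart f.1) (S.graph f.1)),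
    S.lift_mem _ _ (isPartialIso_graph hM f.1)⟩, fun f => ⟨rfl, fun x => ?_⟩, ?_⟩
  · obtain ⟨x, hx⟩ := x
    obtain ⟨a, rfl⟩ := f.2.1 hx
    obtain ⟨b, hb⟩ := f.2.2 (f.1.map ⟨_, hx⟩).2
    rw [← hb]
    exact lift_smul_point (isPartialIso_graph hM f.1) ⟨hx, hb.symm⟩
  · rintro ⟨f, hf⟩ ⟨g, hg⟩ ⟨h, hh⟩ hfgh
    simp only at hfgh
    have hlang : S.langPart h = S.langPart g * S.langPart f := Subtype.ext hfgh.lang_eq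
    have hrr : ∀ b, (∃ a, S.graph f a b) ↔ ∃ c, S.graph g b c := fun b => by
      rw [exists_graph_left hf, exists_graph_right hg, hfgh.range_eq_dom]
    have hgraph : S.graph h = Relation.Comp (S.graph f) (S.graph g) := by
      ext a c
      constructor
      · rintro ⟨ha, hac⟩
        have ha' : S.point a ∈ f.dom := by rwa [hfgh.dom_eq]
        obtain ⟨b, hb⟩ := (exists_graph_right hf a).2 ha'
        obtain ⟨c', hc'⟩ := (hrr b).1 ⟨a, hb⟩
        refine ⟨b, hb, hc'.1, ?_⟩
        have hg' : (f.map ⟨_, ha'⟩ : S.Vertex) ∈ g.dom := by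
          rw [hb.2]
          exact hc'.1
        rw [← hac, hfgh.map_eq _ ha' hg' ha]
        congr 2
        exact Subtype.ext hb.2.symm
      · rintro ⟨b, hb, hc⟩
        have ha : S.point a ∈ h.dom := by
          rw [← hfgh.dom_eq]
          exact hb.1
        have hg' : (f.map ⟨_, hb.1⟩ : S.Vertex) ∈ g.dom := by
          rw [hb.2]
          exact hc.1
        refine ⟨ha, ?_⟩
        rw [hfgh.map_eq _ hb.1 hg' ha, ← hc.2]
        congr 2
        exact Subtype.ext hb.2
    have key : (⟨(S.langPart h, S.lift (S.langPart h) (S.graph h)),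
          S.lift_mem _ _ (isPartialIso_graph hM h)⟩ : S.grp) =
        ⟨(S.langPart g, S.lift (S.langPart g) (S.graph g)),
          S.lift_mem _ _ (isPartialIso_graph hM g)⟩ *
        ⟨(S.langPart f, S.lift (S.langPart f) (S.graph f)),
          S.lift_mem _ _ (isPartialIso_graph hM f)⟩ := by
      refine Subtype.ext (Prod.ext hlang ?_)
      change S.lift (S.langPart h) (S.graph h) = S.lift _ _ * S.lift _ _
      rw [hgraph, hlang]
      exact S.lift_comp _ _ _ _ (isPartialIso_graph hM f) (isPartialIso_graph hM g) hrr
    refine ⟨hfgh.lang_eq, ?_⟩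
    change MulAction.toPerm _ = MulAction.toPerm _ * MulAction.toPerm _
    rw [key]
    ext1 x
    exact mul_smul (_ : S.grp) _ x

/-- Two vertices of the witness are in a common translate of `M`. -/
def Coexist (x y : S.Vertex) : Prop :=
  ∃ (γ : S.grp) (a b : A), x = γ • S.point a ∧ y = γ • S.point b

variable {S}

theorem coexist_of_const_left (hM : M.HasRigidConstants Γ) {c : L.Functions 0} {a : A}
    (ha : a ∈ M.const c) (y : S.Vertex) : S.Coexist (S.point a) y := by
  obtain ⟨γ, b, rfl⟩ := S.exists_eq_smul_point y
  exact ⟨γ, a, b, (smul_point_const hM γ ha).symm, rfl⟩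

theorem Coexist.symm {x y : S.Vertex} (h : S.Coexist x y) : S.Coexist y x := by
  obtain ⟨γ, a, b, hx, hy⟩ := h
  exact ⟨γ, b, a, hy, hx⟩

theorem Coexist.of_reaches (hM : M.HasRigidConstants Γ) {x y x' y' : S.Vertex}
    (h : S.Coexist x y) (hx : S.witness.Reaches x x') (hy : S.witness.Reaches y y') :
    S.Coexist x' y' := by
  obtain ⟨γ, a, b, rfl, rfl⟩ := h
  obtain ⟨a', -, rfl⟩ := S.exists_of_reaches_smul_point hM hx
  obtain ⟨b', -, rfl⟩ := S.exists_of_reaches_smul_point hM hy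
  exact ⟨γ, a', b', rfl, rfl⟩

theorem coexist_self (x : S.Vertex) : S.Coexist x x := by
  obtain ⟨γ, a, rfl⟩ := S.exists_eq_smul_point x
  exact ⟨γ, a, a, rfl, rfl⟩

/-- The vertices which do not reach a given vertex form a substructure. -/
theorem isClosed_not_reaches (hM : M.HasRigidConstants Γ) {V : Set S.Vertex} {x : S.Vertex}
    (hconst : ∀ (c : L.Functions 0), ∀ a ∈ M.const c, ¬ S.witness.Reaches (S.point a) x) :
    (S.witness.induce V).IsClosed {z | ¬ S.witness.Reaches z x} := by
  intro n F t ht w hw hwx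
  change (w : S.Vertex) ∈ S.witness.func F (fun i => (t i : S.Vertex)) at hw
  match n, F, t, ht, hw with
  | 0, F, t, ht, hw =>
    rw [← S.image_point_const hM] at hw
    obtain ⟨a, ha, haw⟩ := hw
    exact hconst F a ha (by rwa [haw])
  | 1, F, t, ht, hw =>
    rw [show (fun i => (t i : S.Vertex)) = ![(t 0 : S.Vertex)] by
      ext1 i
      rw [Subsingleton.elim i 0]
      rfl] at hw
    exact ht 0 ((Reaches.of_mem_func hw).trans hwx)
  | n + 2, F, _, _, _ => exact (hM.isEmpty_functions (n + 2) (by omega)).elim F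

/-- If `x` and `y` share no translate, no vertex reaches both, so the vertices not reaching `x` and
those not reaching `y` cover `V`. A related tuple lies in one translate, hence cannot have one entry
reaching `x` and another reaching `y`; the amalgamation is free. -/
theorem coexist_of_irreducible (hM : M.HasRigidConstants Γ) {V : Set S.Vertex}
    (hirr : (S.witness.induce V).Irreducible) {x y : S.Vertex} (hx : x ∈ V) (hy : y ∈ V) :
    S.Coexist x y := by
  by_contra hxy
  have hne : ∀ z, S.witness.Reaches z x → ¬ S.witness.Reaches z y := fun z h h' =>
    hxy ((coexist_self z).of_reaches hM h h')
  refine hirr ⟨{z | ¬ S.witness.Reaches z x}, {z | ¬ S.witness.Reaches z y}, ?_, ?_, ?_, ?_, ?_,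
    ?_, ?_⟩
  · intro h
    have : (⟨x, hx⟩ : V) ∈ {z : V | ¬ S.witness.Reaches z x} := by
      rw [h]
      trivial
    exact this Relation.ReflTransGen.refl
  · intro h
    have : (⟨y, hy⟩ : V) ∈ {z : V | ¬ S.witness.Reaches z y} := by
      rw [h]
      trivial
    exact this Relation.ReflTransGen.refl
  -- Constants lie in every translate, so one reaching `x` would put `x` in a common translate with
  -- `y`.
  · exact isClosed_not_reaches hM fun c a ha h => hxy <|
      (coexist_of_const_left hM ha y).of_reaches hM h Relation.ReflTransGen.refl
  · exact isClosed_not_reaches hM fun c a ha h => hxy <|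
      ((coexist_of_const_left hM ha x).of_reaches hM (h)
        Relation.ReflTransGen.refl).symm
  · refine Set.eq_univ_of_forall fun z => ?_
    by_cases h : S.witness.Reaches z x
    · exact Or.inr (hne _ h)
    · exact Or.inl h
  · rintro n R t ⟨i, -, hi⟩ ⟨j, -, hj⟩ ⟨γ, R₀, s, -, -, hs⟩
    have hi' : S.witness.Reaches (t i) y := not_not.1 hi
    have hj' : S.witness.Reaches (t j) x := not_not.1 hj
    have : S.Coexist (t j) (t i) := ⟨γ, s j, s i, congrFun hs j, congrFun hs i⟩
    exact hxy (this.of_reaches hM hj' hi')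
  · rintro n F t ⟨i, hi, -⟩ ⟨j, -, hj⟩
    match n, F, t, i, j, hi, hj with
    | 0, _, _, i, _, _, _ => exact i.elim0
    | 1, _, _, i, j, hi, hj =>
      rw [Subsingleton.elim i j] at hi
      exact absurd hi hj
    | n + 2, F, _, _, _, _, _ => exact (hM.isEmpty_functions (n + 2) (by omega)).elim F

/-- Two-determinacy yields one group element moving all first coordinates of `V` into `M`. As `V` is
closed, these include the closures, so the germs become points of `M`. -/
theorem isIrreducibleStructureFaithful (hS : S.IsTwoDetermined)
    (hM : M.HasRigidConstants Γ) : IsIrreducibleStructureFaithful (S.pointEmb hM) := by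
  intro V hV hirr
  have hmaps : S.MapsIn ((fun p : S.Vertex => p.1.1) '' V) := by
    refine hS _ ?_
    rintro _ ⟨x, hx, rfl⟩ _ ⟨y, hy, rfl⟩
    obtain ⟨γ, a, b, rfl, rfl⟩ := coexist_of_irreducible hM hirr hx hy
    refine ⟨γ.1⁻¹, S.grp.inv_mem γ.2, ?_⟩
    have h : ∀ c, S.emb c = γ.1⁻¹.2 ((γ • S.point c).1.1) := fun c =>
      (inv_smul_smul γ (S.emb c)).symm
    rintro _ (rfl | rfl)
    · exact ⟨a, h a⟩
    · exact ⟨b, h b⟩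
  obtain ⟨γ, hγ, h⟩ := hmaps
  refine ⟨S.aut ⟨γ, hγ⟩, ?_⟩
  rintro _ ⟨x, hx, rfl⟩
  obtain ⟨δ, a, rfl⟩ := S.exists_eq_smul_point x
  have h' : ∀ c, M.Reaches a c → ∃ d, ((⟨γ, hγ⟩ : S.grp) * δ) • S.emb c = S.emb d := by
    intro c hc
    obtain ⟨d, hd⟩ := h _ ⟨_, hV.mem_of_reaches hx (S.reaches_smul_point hM δ hc), rfl⟩
    exact ⟨d, hd.symm⟩
  obtain ⟨b, hb⟩ := h' a Relation.ReflTransGen.refl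
  refine ⟨b, ?_⟩
  exact (smul_point_of_emb hb h').symm.trans (mul_smul _ _ _)

end ExtensionSystem

end EPPA

theorem theorem12p3 (L : FirstOrder.Language.{u, v}) (Γ : Subgroup (EPPA.LangPerm L))
    (hRel : IsEmpty (L.Relations 0))
    (hFun : ∀ n : ℕ, 2 ≤ n → IsEmpty (L.Functions n))
    (A : Type w) [Finite A] (M : EPPA.GStr L A)
    (hfix : ∀ g ∈ Γ, ∀ c : L.Functions 0, g.2 0 c = c)
    (hfin : Finite (L.Functions 0))
    (hsing : ∀ c : L.Functions 0, ∃ a : A, M.const c = {a})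
    (hdist : ∀ c c' : L.Functions 0, c ≠ c' → M.const c ≠ M.const c')
    (hempty : ∀ (c : L.Functions 0) (F : L.Functions 1) (a : A),
      M.const c = {a} → M.func F ![a] = ∅)
    (horbit : (M.relabelOrbit Γ).Finite) :
    ∃ (B : Type w) (_ : Finite B) (N : EPPA.GStr L B) (ψ : EPPA.Emb Γ M N),
      EPPA.IsCoherentEPPAWitness ψ ∧ EPPA.IsIrreducibleStructureFaithful ψ := by
  have hM : M.HasRigidConstants Γ := by
    refine ⟨hFun, hfix, hsing, fun c F a ha => ?_⟩
    obtain ⟨b, hb⟩ := hsing c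
    rw [hb, Set.mem_singleton_iff] at ha
    exact hempty c F a (ha ▸ hb)
  obtain ⟨X, _, ⟨S⟩⟩ := EPPA.exists_extensionSystem hRel M horbit
  exact ⟨S.coloured.Vertex, inferInstance, S.coloured.witness, S.coloured.pointEmb hM,
    S.coloured.isCoherentEPPAWitness hM,
    EPPA.ExtensionSystem.isIrreducibleStructureFaithful S.isTwoDetermined_coloured hM⟩
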